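/- Let $\mathbf{V\#L}$ be the two-sorted theory (numbers, and strings, i.e. finite sets of numbers) over the vocabulary $0,1,+,\cdot,|\cdot|,\in,\le,=$ with the following axioms: the 2-BASIC axioms of Cook and Nguyen; comprehension $\exists X\,(|X|\le y\wedge\forall x<y\,(X(x)\leftrightarrow\varphi(x)))$ for every $\Sigma^B_0$ formula $\varphi$ in which $X$ is not free; string multiplication $\forall X,Y\,\exists Z\,(Z=X\cdot Y)$, where strings are read as binary numbers; and matrix powering, which says that for every square matrix $X$ over $\mathbb Z$ (coded by a string, with entries in binary) and every number $n$ there is a string $Y$ with $Y=X^n$. In $\mathbf{V\#L}$ the Pfaffian of a skew symmetric integer matrix $A$ of order $2N$ is defined by the PB recursion, as follows. Let $J$ denote the block diagonal matrix with blocks $\begin{pmatrix}0&1\\-1&0\end{pmatrix}$, of the order that the context requires. For $N\ge 1$ write $$A=\begin{pmatrix}0&a&R\\-a&0&-S^{t}\\-R^{t}&S&M\end{pmatrix},$$ where $M$ has order $2N-2$, and let $P_A$ be the $(N+1)\times N$ lower triangular Toeplitz matrix with first column $1,\ a,\ RJS,\ RJ(MJ)S,\ \dots,\ RJ(MJ)^{N-2}S$.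 The Pfaffian coefficients $\bar p_A=(p_N,\dots,p_0)$ are given by $\bar p_A=P_A\,\bar p_M$, starting from the sequence $(1)$ for the empty matrix, so that $\bar p_A=(1,a)$ when $N=1$. Then $\mathrm{pf}(A)=p_0$. **Theorem.** $\mathbf{V\#L}$ proves that for every number $n$, if $I$ is the $2n\times 2n$ identity matrix, then $$\mathrm{pf}\begin{pmatrix}0&I\\-I&0\end{pmatrix}=(-1)^n .$$ That is, $\mathbf{V\#L}$ proves that this $4n\times 4n$ matrix exists, that its Pfaffian (as computed by the PB recursion) exists, and that every value of the Pfaffian equals $(-1)^n$. -/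

import Mathlib

universe u v

namespace VSharpL

/-! ## Two-sorted first-order logic over the vocabulary `0, 1, +, ·, |·|, ∈, ≤, =₁, =₂` -/

/-- Terms of the number sort. Number variables and string variables are both named by natural
numbers. The only string terms of the vocabulary are the string variables. -/
inductive NTerm : Type
  | var (x : ℕ) : NTerm
  | zero : NTerm
  | one : NTerm
  | add (s t : NTerm) : NTerm
  | mul (s t : NTerm) : NTerm
  | len (X : ℕ) : NTerm

instance : Zero NTerm := ⟨NTerm.zero⟩
instance : One NTerm := ⟨NTerm.one⟩
instance : Add NTerm := ⟨NTerm.add⟩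
instance : Mul NTerm := ⟨NTerm.mul⟩

/-- The number variable `x` occurs in a term. -/
def NTerm.Occurs (x : ℕ) : NTerm → Prop
  | .var y => x = y
  | .zero => False
  | .one => False
  | .add s t => s.Occurs x ∨ t.Occurs x
  | .mul s t => s.Occurs x ∨ t.Occurs x
  | .len _ => False

/-- The string variable `X` occurs in a term. -/
def NTerm.OccursStr (X : ℕ) : NTerm → Prop
  | .var _ => False
  | .zero => False
  | .one => False
  | .add s t => s.OccursStr X ∨ t.OccursStr X
  | .mul s t => s.OccursStr X ∨ t.OccursStr X
  | .len Y => X = Y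

/-- Two-sorted formulas; `mem t X` is the atom `t ∈ X`, also written `X(t)`. -/
inductive Formula : Type
  | eqN (s t : NTerm) : Formula
  | eqS (X Y : ℕ) : Formula
  | le (s t : NTerm) : Formula
  | mem (t : NTerm) (X : ℕ) : Formula
  | neg (φ : Formula) : Formula
  | and (φ ψ : Formula) : Formula
  | or (φ ψ : Formula) : Formula
  | allN (x : ℕ) (φ : Formula) : Formula
  | exN (x : ℕ) (φ : Formula) : Formula
  | allS (X : ℕ) (φ : Formula) : Formula
  | exS (X : ℕ) (φ : Formula) : Formula

/-- The string variable `X` occurs free in a formula. -/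
def Formula.FreeStr (X : ℕ) : Formula → Prop
  | .eqN s t => s.OccursStr X ∨ t.OccursStr X
  | .eqS Y Z => X = Y ∨ X = Z
  | .le s t => s.OccursStr X ∨ t.OccursStr X
  | .mem t Y => t.OccursStr X ∨ X = Y
  | .neg φ => φ.FreeStr X
  | .and φ ψ => φ.FreeStr X ∨ ψ.FreeStr X
  | .or φ ψ => φ.FreeStr X ∨ ψ.FreeStr X
  | .allN _ φ => φ.FreeStr X
  | .exN _ φ => φ.FreeStr X
  | .allS Y φ => X ≠ Y ∧ φ.FreeStr X
  | .exS Y φ => X ≠ Y ∧ φ.FreeStr X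

def Formula.imp (φ ψ : Formula) : Formula := .or (.neg φ) ψ
def Formula.iff (φ ψ : Formula) : Formula := .and (.imp φ ψ) (.imp ψ φ)
def Formula.xor (φ ψ : Formula) : Formula := .neg (.iff φ ψ)
def Formula.lt (s t : NTerm) : Formula := .and (.le s t) (.neg (.eqN s t))

infix:50 " ≐ " => Formula.eqN
infix:50 " ≼ " => Formula.le
infix:50 " ≺ " => Formula.lt
infixr:35 " ⋏ " => Formula.and
infixr:30 " ⋎ " => Formula.or
infixr:25 " ⇛ " => Formula.imp
infix:20 " ⟺ " => Formula.iff

/-- A two-sorted structure for the vocabulary; both equality symbols are interpreted by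
equality. -/
structure Model : Type (max (u + 1) (v + 1)) where
  Num : Type u
  Str : Type v
  str_nonempty : Nonempty Str
  zero : Num
  one : Num
  add : Num → Num → Num
  mul : Num → Num → Num
  len : Str → Num
  le : Num → Num → Prop
  mem : Num → Str → Prop

/-- The value of a term under an assignment `e` of the number and `E` of the string variables. -/
def NTerm.eval (M : Model.{u, v}) (e : ℕ → M.Num) (E : ℕ → M.Str) : NTerm → M.Num
  | .var x => e x
  | .zero => M.zero
  | .one => M.one
  | .add s t => M.add (s.eval M e E) (t.eval M e E)
  | .mul s t => M.mul (s.eval M e E) (t.eval M e E)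
  | .len X => M.len (E X)

/-- Tarski satisfaction. -/
def Formula.Sat (M : Model.{u, v}) : (ℕ → M.Num) → (ℕ → M.Str) → Formula → Prop
  | e, E, .eqN s t => s.eval M e E = t.eval M e E
  | _, E, .eqS X Y => E X = E Y
  | e, E, .le s t => M.le (s.eval M e E) (t.eval M e E)
  | e, E, .mem t X => M.mem (t.eval M e E) (E X)
  | e, E, .neg φ => ¬ φ.Sat M e E
  | e, E, .and φ ψ => φ.Sat M e E ∧ ψ.Sat M e E
  | e, E, .or φ ψ => φ.Sat M e E ∨ ψ.Sat M e E
  | e, E, .allN x φ => ∀ a : M.Num, φ.Sat M (Function.update e x a) E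
  | e, E, .exN x φ => ∃ a : M.Num, φ.Sat M (Function.update e x a) E
  | e, E, .allS X φ => ∀ A : M.Str, φ.Sat M e (Function.update E X A)
  | e, E, .exS X φ => ∃ A : M.Str, φ.Sat M e (Function.update E X A)

/-- A structure is a model of a set of axioms if the universal closure of each axiom holds. -/
def Model.Models (M : Model.{u, v}) (T : Set Formula) : Prop :=
  ∀ φ ∈ T, ∀ (e : ℕ → M.Num) (E : ℕ → M.Str), φ.Sat M e E

/-- `T ⊢ φ`. The theory with axioms `T` is the closure of `T` under logical consequence and
universal closure, and it proves its elements. -/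
def Proves (T : Set Formula) (φ : Formula) : Prop :=
  ∀ M : Model.{u, v}, M.Models T → M.Models {φ}

/-! ## The base theory: 2-BASIC and comprehension for bounded formulas -/

/-- `Σ₀ᴮ` formulas: no string quantifiers, and all number quantifiers bounded. -/
inductive IsSigmaB0 : Formula → Prop
  | eqN (s t : NTerm) : IsSigmaB0 (.eqN s t)
  | eqS (X Y : ℕ) : IsSigmaB0 (.eqS X Y)
  | le (s t : NTerm) : IsSigmaB0 (.le s t)
  | mem (t : NTerm) (X : ℕ) : IsSigmaB0 (.mem t X)
  | neg {φ : Formula} : IsSigmaB0 φ → IsSigmaB0 (.neg φ)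
  | and {φ ψ : Formula} : IsSigmaB0 φ → IsSigmaB0 ψ → IsSigmaB0 (.and φ ψ)
  | or {φ ψ : Formula} : IsSigmaB0 φ → IsSigmaB0 ψ → IsSigmaB0 (.or φ ψ)
  | ball {x : ℕ} {t : NTerm} {φ : Formula} : ¬ t.Occurs x → IsSigmaB0 φ →
      IsSigmaB0 (.allN x (.var x ≼ t ⇛ φ))
  | bex {x : ℕ} {t : NTerm} {φ : Formula} : ¬ t.Occurs x → IsSigmaB0 φ →
      IsSigmaB0 (.exN x (.var x ≼ t ⋏ φ))

/-- The axioms 2-BASIC, with `x = var 0`, `y = var 1` and string variables `X = 0`, `Y = 1`. -/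
def basic : Set Formula :=
  let x : NTerm := .var 0
  let y : NTerm := .var 1
  { .neg (x + 1 ≐ 0),
    x + 1 ≐ y + 1 ⇛ x ≐ y,
    x + 0 ≐ x,
    x + (y + 1) ≐ (x + y) + 1,
    x * 0 ≐ 0,
    x * (y + 1) ≐ (x * y) + x,
    x ≼ y ⋏ y ≼ x ⇛ x ≐ y,
    x ≼ x + y,
    0 ≼ x,
    x ≼ y ⋎ y ≼ x,
    x ≼ y ⟺ x ≺ y + 1,
    .neg (x ≐ 0) ⇛ .exN 1 (y ≼ x ⋏ y + 1 ≐ x),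
    .mem y 0 ⇛ y ≺ .len 0,
    y + 1 ≐ .len 0 ⇛ .mem y 0,
    .len 0 ≐ .len 1 ⋏ .allN 0 (x ≺ .len 0 ⇛ (.mem x 0 ⟺ .mem x 1)) ⇛ .eqS 0 1 }

/-- The comprehension axiom `∃ X ≤ y, ∀ x < y, (X(x) ↔ φ(x))`. -/
def compAxiom (φ : Formula) (x y X : ℕ) : Formula :=
  .exS X (.len X ≼ .var y ⋏
    .allN x (.var x ≺ .var y ⇛ (.mem (.var x) X ⟺ φ)))

def sigmaB0Comp : Set Formula :=
  {ψ | ∃ (φ : Formula) (x y X : ℕ), IsSigmaB0 φ ∧ x ≠ y ∧ ¬ φ.FreeStr X ∧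
    ψ = compAxiom φ x y X}

/-! ## Arithmetic and linear algebra inside the theory

The formulas below are built by functions that take terms and "bit predicates" as arguments.
Quantifiers are written `allNum 7 fun i => …`, where `7` is the name of the bound variable; the
names are chosen so that no argument contains a variable bound inside the function. -/

def allNum (x : ℕ) (f : NTerm → Formula) : Formula := .allN x (f (.var x))
def exNum (x : ℕ) (f : NTerm → Formula) : Formula := .exN x (f (.var x))
def allStr (X : ℕ) (f : ℕ → Formula) : Formula := .allS X (f X)
def exStr (X : ℕ) (f : ℕ → Formula) : Formula := .exS X (f X)

/-- A finite set of positions given by a membership formula: a string, or a row of an array. -/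
abbrev Bits : Type := NTerm → Formula

def bits (X : ℕ) : Bits := fun i => .mem i X

def eqBits (b c : Bits) : Formula := allNum 0 fun i => b i ⟺ c i
def emptyBits (b : Bits) : Formula := allNum 1 fun i => .neg (b i)

/-! ### Natural numbers in binary: `b` stands for `∑ 2 ^ i` over the positions `i` in `b` -/

/-- There is a carry into position `i` when adding `b` and `c`. -/
def carry (b c : Bits) (i : NTerm) : Formula :=
  exNum 2 fun k => k ≺ i ⋏ b k ⋏ c k ⋏ allNum 3 fun j => k ≺ j ⋏ j ≺ i ⇛ b j ⋎ c j

/-- `b + c = d`. -/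
def natAdd (b c d : Bits) : Formula :=
  allNum 4 fun i => d i ⟺ ((b i).xor (c i)).xor (carry b c i)

/-- `2 ^ s * b`. -/
def shift (s : NTerm) (b : Bits) : Bits := fun j => exNum 5 fun t => t + s ≐ j ⋏ b t

/-- The `l`-th row of the array `W`, where `pair` is the usual pairing function. -/
def pair (x y : NTerm) : NTerm := (x + y) * (x + y + 1) + (1 + 1) * y
def row (W : ℕ) (l : NTerm) : Bits := fun i => .mem (pair l i) W

/-- `b * c = d`: the array `W` lists the products `b * (c mod 2 ^ i)` for `i ≤ l`, where all
positions in `c` are below `l`. -/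
def natMul (b c d : Bits) : Formula :=
  exNum 6 fun l => (allNum 7 fun i => c i ⇛ i ≺ l) ⋏ exStr 0 fun W =>
    emptyBits (row W 0) ⋏
    (allNum 8 fun i => i ≺ l ⇛
      (c i ⇛ natAdd (row W i) (shift i b) (row W (i + 1))) ⋏
      (.neg (c i) ⇛ eqBits (row W (i + 1)) (row W i))) ⋏
    eqBits (row W l) d

/-! ### Integers: position `0` is the sign (present iff negative), the rest the magnitude -/

def sign (b : Bits) : Formula := b 0
def mag (b : Bits) : Bits := fun i => b (i + 1)

def nonzero (b : Bits) : Formula := exNum 9 fun i => mag b i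

/-- Zero is not negative, so every integer has exactly one code. -/
def isInt (b : Bits) : Formula := sign b ⇛ nonzero b

def isZero (b : Bits) : Formula := emptyBits b
def isOne (b : Bits) : Formula := allNum 10 fun i => b i ⟺ i ≐ 1
def isNegOne (b : Bits) : Formula := allNum 11 fun i => b i ⟺ (i ≐ 0 ⋎ i ≐ 1)

/-- `b + c = d` for integers. -/
def intAdd (b c d : Bits) : Formula :=
  isInt d ⋏
  ((((sign b ⟺ sign c) ⋏ (sign d ⟺ sign b) ⋏ natAdd (mag b) (mag c) (mag d))) ⋎
   ((sign b).xor (sign c) ⋏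
     (((sign d ⟺ sign b) ⋏ natAdd (mag c) (mag d) (mag b)) ⋎
      ((sign d ⟺ sign c) ⋏ natAdd (mag b) (mag d) (mag c)))))

/-- `b * c = d` for integers. -/
def intMul (b c d : Bits) : Formula :=
  isInt d ⋏ natMul (mag b) (mag c) (mag d) ⋏
    (nonzero d ⇛ (sign d ⟺ (sign b).xor (sign c)))

/-! ### Matrices, with rows and columns numbered from `0` -/

abbrev Mat : Type := NTerm → NTerm → Bits

/-- The two-dimensional array of integers coded by the string `X`. -/
def mat (X : ℕ) : Mat := fun a b i => .mem (pair (pair a b) i) X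

/-- The `k`-th entry of the sequence of two-dimensional arrays coded by the string `P`. -/
def mats (P : ℕ) (k : NTerm) : Mat := fun a b i => .mem (pair (pair (pair k a) b) i) P

/-- The block of `A` that starts in row `s` and column `t`. -/
def block (A : Mat) (s t : NTerm) : Mat := fun a b => A (s + a) (t + b)

/-- The entries of `A` in the range `p × q` are integers. -/
def isMat (p q : NTerm) (A : Mat) : Formula :=
  allNum 12 fun a => allNum 13 fun b => a ≺ p ⋏ b ≺ q ⇛ isInt (A a b)

def eqMat (p q : NTerm) (A B : Mat) : Formula :=
  allNum 14 fun a => allNum 15 fun b => a ≺ p ⋏ b ≺ q ⇛ eqBits (A a b) (B a b)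

/-- `A` is the identity matrix of order `m`. -/
def isId (m : NTerm) (A : Mat) : Formula :=
  allNum 16 fun a => allNum 17 fun b => a ≺ m ⋏ b ≺ m ⇛
    (a ≐ b ⇛ isOne (A a b)) ⋏ (.neg (a ≐ b) ⇛ isZero (A a b))

/-- `∑ l < q, A a l * B l b = d`; the array `T` lists the partial sums. -/
def dot (q : NTerm) (A B : Mat) (a b : NTerm) (d : Bits) : Formula :=
  exStr 1 fun T =>
    isZero (row T 0) ⋏
    (allNum 18 fun l => l ≺ q ⇛ exStr 2 fun V =>
      intMul (A a l) (B l b) (bits V) ⋏ intAdd (row T l) (bits V) (row T (l + 1))) ⋏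
    eqBits (row T q) d

/-- `A * B = C`, with `A` of size `p × q`, `B` of size `q × r` and `C` of size `p × r`. -/
def matMul (p q r : NTerm) (A B C : Mat) : Formula :=
  allNum 19 fun a => allNum 20 fun b => a ≺ p ⋏ b ≺ r ⇛ dot q A B a b (C a b)

/-- `A ^ n = B` for matrices of order `m`; the string `P` lists the powers of `A`. -/
def matPow (m : NTerm) (A : Mat) (n : NTerm) (B : Mat) : Formula :=
  exStr 3 fun P =>
    isId m (mats P 0) ⋏
    (allNum 21 fun k => k ≺ n ⇛ matMul m m m (mats P k) A (mats P (k + 1))) ⋏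
    eqMat m m (mats P n) B

/-! ## The theory `V#L` -/

/-- `∀ X Y, ∃ Z, Z = X * Y`. -/
def stringMultiplication : Formula :=
  allStr 10 fun X => allStr 11 fun Y => exStr 12 fun Z => natMul (bits X) (bits Y) (bits Z)

/-- For every square integer matrix `X` and every `n` there is `Y = X ^ n`. -/
def matrixPowering : Formula :=
  allNum 30 fun m => allNum 31 fun n => allStr 10 fun X =>
    isMat m m (mat X) ⇛ exStr 11 fun Y => matPow m (mat X) n (mat Y)

def theory : Set Formula :=
  basic ∪ sigmaB0Comp ∪ {stringMultiplication, matrixPowering}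

/-! ## The Pfaffian through the PB algorithm -/

/-- `A` is the matrix `J` of order `m` (`m` even): the block diagonal matrix with blocks
`(0, 1; -1, 0)`. -/
def isJ (m : NTerm) (A : Mat) : Formula :=
  let upper (a b : NTerm) : Formula := exNum 40 fun t => a ≐ t + t ⋏ b ≐ t + t + 1
  allNum 41 fun a => allNum 42 fun b => a ≺ m ⋏ b ≺ m ⇛
    (upper a b ⇛ isOne (A a b)) ⋏
    (upper b a ⇛ isNegOne (A a b)) ⋏
    (.neg (upper a b) ⋏ .neg (upper b a) ⇛ isZero (A a b))

/-- `R J (M J) ^ r S = z`, for `R` of size `1 × m`, `M` of size `m × m` and `S` of size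
`m × 1`. -/
def pbCoeff (m : NTerm) (R M S : Mat) (r : NTerm) (z : Bits) : Formula :=
  exStr 20 fun J => exStr 21 fun MJ => exStr 22 fun P => exStr 23 fun RJ => exStr 24 fun U =>
    isJ m (mat J) ⋏
    matMul m m m M (mat J) (mat MJ) ⋏
    matPow m (mat MJ) r (mat P) ⋏
    matMul 1 m m R (mat J) (mat RJ) ⋏
    matMul 1 m m (mat RJ) (mat P) (mat U) ⋏
    dot m (mat U) S 0 0 z

/-- `P` is the PB matrix, of size `(d + 2) × (d + 1)`, of the skew symmetric matrix `A` of order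
`2 * (d + 1)` with block decomposition
`(0, a, R; -a, 0, -Sᵀ; -Rᵀ, S, M)`. It is a lower triangular Toeplitz matrix with first column
`1, a, R J S, R J (M J) S, …, R J (M J) ^ (d - 1) S`. -/
def isPBMatrix (d : NTerm) (A P : Mat) : Formula :=
  allNum 43 fun i => allNum 44 fun j => i ≺ d + 1 + 1 ⋏ j ≺ d + 1 ⇛
    (i ≺ j ⇛ isZero (P i j)) ⋏
    (i ≐ j ⇛ isOne (P i j)) ⋏
    (i ≐ j + 1 ⇛ eqBits (P i j) (A 0 1)) ⋏
    (allNum 45 fun r => i ≐ j + 1 + 1 + r ⇛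
      pbCoeff (d + d) (block A 0 (1 + 1)) (block A (1 + 1) (1 + 1)) (block A (1 + 1) 1) r (P i j))

/-- `pf A = z` for a skew symmetric matrix `A` of order `2 * N`. Row `k` of the array `Q` is the
sequence `(p_{N-k}, …, p_0)` of Pfaffian coefficients of the lower right block `A_k` of `A` of order
`2 * (N - k)`. The sequence of the empty matrix `A_N` is `(1)`, and the sequence of `A_k` is the PB
matrix of `A_k` times the sequence of `A_{k+1}`; in particular it is `(1, a)` for a matrix
`(0, a; -a, 0)`. The Pfaffian is the last coefficient `p_0` of `A_0 = A`. -/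
def pfaffian (N : NTerm) (A : Mat) (z : Bits) : Formula :=
  exStr 25 fun Q =>
    isOne (mat Q N 0) ⋏
    (allNum 46 fun k => allNum 47 fun d => k + d + 1 ≐ N ⇛ exStr 26 fun P =>
      isPBMatrix d (block A (k + k) (k + k)) (mat P) ⋏
      matMul (d + 1 + 1) (d + 1) 1 (mat P)
        (fun j _ => mat Q (k + 1) j) (fun i _ => mat Q k i)) ⋏
    eqBits (mat Q 0 N) z

/-- `A` is the matrix `(0, I; -I, 0)` of order `2 * N`, where `I` is the identity matrix of
order `N`. -/
def isBlockIdentity (N : NTerm) (A : Mat) : Formula :=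
  allNum 50 fun a => allNum 51 fun b => a ≺ N + N ⋏ b ≺ N + N ⇛
    (b ≐ a + N ⇛ isOne (A a b)) ⋏
    (a ≐ b + N ⇛ isNegOne (A a b)) ⋏
    (.neg (b ≐ a + N) ⋏ .neg (a ≐ b + N) ⇛ isZero (A a b))

/-- `z = (-1) ^ n`. -/
def isNegOnePow (n : NTerm) (z : Bits) : Formula :=
  ((exNum 52 fun t => n ≐ t + t) ⋏ isOne z) ⋎
  ((exNum 53 fun t => n ≐ t + t + 1) ⋏ isNegOne z)

/-- For all `n`, the matrix `A = (0, I; -I, 0)` with `I` of order `2 * n` exists, its Pfaffian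
exists, and every value of its Pfaffian is `(-1) ^ n`. -/
def pfBlockIdentity : Formula :=
  allNum 60 fun n =>
    (exStr 30 fun A => isBlockIdentity (n + n) (mat A)) ⋏
    (allStr 30 fun A => isBlockIdentity (n + n) (mat A) ⇛
      (exStr 31 fun Z => pfaffian (n + n) (mat A) (bits Z)) ⋏
      (allStr 31 fun Z => pfaffian (n + n) (mat A) (bits Z) ⇛ isNegOnePow n (bits Z)))

end VSharpL

set_option linter.unusedSectionVars false
set_option linter.unusedVariables false

namespace VSharpL

/-! ### Renaming of variables -/

/-! Provability means truth in all models, so the computation takes place inside an arbitrary model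
`M` of V#L. Let A be the given matrix of order 4n and A_k the matrix A without its first 2k rows and
columns. In A, row i meets only column i + 2n or i - 2n. Hence the entry a of A_k is 0, because 2n ≠
1. If k ≥ n, then R = 0, and the PB matrix is an identity matrix above a zero row. If k < n, then R
has a single 1 in column 2n-2 and S has a single -1 in row 2n-1, so RJS = -1. Column 2n-2 of M is
zero, since its partner row 2k of A has been deleted; so column 2n-1 of MJ is zero, and RJ(MJ)^r S =
0 for r ≥ 1. Thus for k < n the PB matrix is multiplication by 1 - X^2 (`pbCoeffP_iff`,
`isPBMatrixP_block_iff`). For k ≤ n the coefficients of A_k are those of (1 - X^2)^(n-k), padded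
with zeros, and p_0 is the coefficient of X^(2n) in (1 - X^2)^n, which is (-1)^n.

That every value is (-1)^n needs only the leading coefficient and the zeros beyond it, by induction
on a bounded formula (`CoeffRec.of_ge`, `CoeffRec.of_le`). Existence needs the whole table of
coefficients. Matrix powering supplies it: row 0 of the c-th power of the matrix of 1 - X^2 lists
the coefficients of (1 - X^2)^c (`exists_powers`, `exists_coeffRec`).

All inner products that are evaluated have at most two nonzero terms (`dotV_zero_iff`,
`dotV_single_iff`, `dotV_double_iff`), and one factor of each term is 0, 1 or -1. So no general
integer arithmetic has to be developed. Comprehension and induction are applied through the classes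
`DefTerm` and `DefPred`, whose instances find the bounded formula that defines a given predicate. -/

def NTerm.rename (f g : ℕ → ℕ) : NTerm → NTerm
  | .var x => .var (f x)
  | .zero => .zero
  | .one => .one
  | .add s t => .add (s.rename f g) (t.rename f g)
  | .mul s t => .mul (s.rename f g) (t.rename f g)
  | .len X => .len (g X)

def Formula.rename (f g : ℕ → ℕ) : Formula → Formula
  | .eqN s t => .eqN (s.rename f g) (t.rename f g)
  | .eqS X Y => .eqS (g X) (g Y)
  | .le s t => .le (s.rename f g) (t.rename f g)
  | .mem t Y => .mem (t.rename f g) (g Y)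
  | .neg φ => .neg (φ.rename f g)
  | .and φ ψ => .and (φ.rename f g) (ψ.rename f g)
  | .or φ ψ => .or (φ.rename f g) (ψ.rename f g)
  | .allN x φ => .allN (f x) (φ.rename f g)
  | .exN x φ => .exN (f x) (φ.rename f g)
  | .allS Y φ => .allS (g Y) (φ.rename f g)
  | .exS Y φ => .exS (g Y) (φ.rename f g)

theorem NTerm.eval_rename {M : Model.{u, v}} (f g : ℕ → ℕ) (t : NTerm) (e : ℕ → M.Num)
    (E : ℕ → M.Str) : (t.rename f g).eval M e E = t.eval M (e ∘ f) (E ∘ g) := by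
  induction t with
  | var => rfl
  | zero => rfl
  | one => rfl
  | len => rfl
  | add s t hs ht => simp only [NTerm.rename, NTerm.eval, hs, ht]
  | mul s t hs ht => simp only [NTerm.rename, NTerm.eval, hs, ht]

theorem NTerm.exists_of_occurs_rename {f g : ℕ → ℕ} {y : ℕ} :
    ∀ {t : NTerm}, (t.rename f g).Occurs y → ∃ x, t.Occurs x ∧ f x = y
  | .var x, h => ⟨x, rfl, Eq.symm h⟩
  | .zero, h => h.elim
  | .one, h => h.elim
  | .len _, h => h.elim
  | .add _ _, h => h.elim
      (fun h => let ⟨x, hx, hy⟩ := exists_of_occurs_rename h; ⟨x, .inl hx, hy⟩)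
      (fun h => let ⟨x, hx, hy⟩ := exists_of_occurs_rename h; ⟨x, .inr hx, hy⟩)
  | .mul _ _, h => h.elim
      (fun h => let ⟨x, hx, hy⟩ := exists_of_occurs_rename h; ⟨x, .inl hx, hy⟩)
      (fun h => let ⟨x, hx, hy⟩ := exists_of_occurs_rename h; ⟨x, .inr hx, hy⟩)

theorem NTerm.not_occurs_rename {f g : ℕ → ℕ} {y : ℕ} (h : ∀ x, f x ≠ y) (t : NTerm) :
    ¬ (t.rename f g).Occurs y := fun ht =>
  let ⟨x, _, hx⟩ := exists_of_occurs_rename ht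
  h x hx

/-- Injectivity on number variables keeps a quantified variable out of the term that bounds it. -/
theorem IsSigmaB0.rename {f g : ℕ → ℕ} (hf : f.Injective) {φ : Formula} (h : IsSigmaB0 φ) :
    IsSigmaB0 (φ.rename f g) := by
  have occ {x : ℕ} {t : NTerm} (ht : ¬ t.Occurs x) : ¬ (t.rename f g).Occurs (f x) := fun h => by
    obtain ⟨y, hy, hxy⟩ := NTerm.exists_of_occurs_rename h
    exact ht (hf hxy ▸ hy)
  induction h with
  | eqN => exact .eqN _ _
  | eqS => exact .eqS _ _
  | le => exact .le _ _
  | mem => exact .mem _ _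
  | neg _ h => exact .neg h
  | and _ _ h h' => exact .and h h'
  | or _ _ h h' => exact .or h h'
  | ball ht _ h => exact .ball (occ ht) h
  | bex ht _ h => exact .bex (occ ht) h

/-- Updating an assignment commutes with an injective renaming. There are no string quantifiers, so
`g` may be arbitrary. -/
theorem IsSigmaB0.sat_rename {M : Model.{u, v}} {f g : ℕ → ℕ} (hf : f.Injective) {φ : Formula}
    (h : IsSigmaB0 φ) (e : ℕ → M.Num) (E : ℕ → M.Str) :
    (φ.rename f g).Sat M e E ↔ φ.Sat M (e ∘ f) (E ∘ g) := by
  induction h generalizing e with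
  | eqN => simp only [Formula.rename, Formula.Sat, NTerm.eval_rename]
  | eqS => rfl
  | le => simp only [Formula.rename, Formula.Sat, NTerm.eval_rename]
  | mem => simp only [Formula.rename, Formula.Sat, NTerm.eval_rename]; rfl
  | neg _ h => simp only [Formula.rename, Formula.Sat, h]
  | and _ _ h h' => simp only [Formula.rename, Formula.Sat, h, h']
  | or _ _ h h' => simp only [Formula.rename, Formula.Sat, h, h']
  | ball ht _ h => simp only [Formula.rename, Formula.imp, Formula.Sat, NTerm.eval_rename, h,
      Function.update_comp_eq_of_injective _ hf]
  | bex ht _ h => simp only [Formula.rename, Formula.Sat, NTerm.eval_rename, h,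
      Function.update_comp_eq_of_injective _ hf]

theorem NTerm.not_occursStr_rename {f g : ℕ → ℕ} {X : ℕ} (hg : ∀ Y, g Y ≠ X) (t : NTerm) :
    ¬ (t.rename f g).OccursStr X := by
  induction t with
  | var => exact id
  | zero => exact id
  | one => exact id
  | len Y => exact fun h => hg Y (Eq.symm h)
  | add s t hs ht => exact fun h => h.elim hs ht
  | mul s t hs ht => exact fun h => h.elim hs ht

theorem Formula.not_freeStr_rename {f g : ℕ → ℕ} {X : ℕ} (hg : ∀ Y, g Y ≠ X) (φ : Formula) :
    ¬ (φ.rename f g).FreeStr X := by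
  have ht := NTerm.not_occursStr_rename (f := f) hg
  induction φ with
  | eqN s t => exact fun h => h.elim (ht _) (ht _)
  | eqS Y Z => exact fun h => h.elim (fun h => hg _ h.symm) (fun h => hg _ h.symm)
  | le s t => exact fun h => h.elim (ht _) (ht _)
  | mem t Y => exact fun h => h.elim (ht _) (fun h => hg _ h.symm)
  | neg φ h => exact h
  | and φ ψ h h' => exact fun h'' => h''.elim h h'
  | or φ ψ h h' => exact fun h'' => h''.elim h h'
  | allN x φ h => exact h
  | exN x φ h => exact h
  | allS X φ h => exact fun h' => h h'.2
  | exS X φ h => exact fun h' => h h'.2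

/-! ### Definable terms and predicates

Environments `e : ℕ → M.Num` interpret de Bruijn indices; parameters of both sorts are allowed. -/

/-- The numbering of bound variables (left) and parameters (right). -/
def idx : ℕ ⊕ ℕ ≃ ℕ := Equiv.natSumNatEquivNat

/-- The assignment that interleaves an environment and an assignment of parameters. -/
def interleave {α : Type*} (e p : ℕ → α) (i : ℕ) : α :=
  Sum.elim e p (idx.symm i)

def mapIndex (f : ℕ ⊕ ℕ → ℕ ⊕ ℕ) (i : ℕ) : ℕ :=
  idx (f (idx.symm i))

theorem mapIndex_injective {f : ℕ ⊕ ℕ → ℕ ⊕ ℕ} (hf : f.Injective) : (mapIndex f).Injective :=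
  idx.injective.comp (hf.comp idx.symm.injective)

theorem interleave_comp_mapIndex {α : Type*} (e p : ℕ → α) (f : ℕ ⊕ ℕ → ℕ ⊕ ℕ) :
    interleave e p ∘ mapIndex f =
      fun i => Sum.elim e p (f (idx.symm i)) := by
  funext i; simp [interleave, mapIndex]

theorem interleave_comp_mapIndex_sumMap {α : Type*} (e p : ℕ → α) (g : ℕ → ℕ) :
    interleave e p ∘ mapIndex (Sum.map id g) = interleave e (p ∘ g) := by
  rw [interleave_comp_mapIndex]
  funext i
  unfold interleave
  cases idx.symm i <;> rfl

theorem interleave_comp_inl {α : Type*} (e p : ℕ → α) :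
    interleave e p ∘ (fun i => idx (.inl i)) = e := by
  funext i; simp [interleave]

theorem interleave_comp_inr {α : Type*} (e p : ℕ → α) :
    interleave e p ∘ (fun i => idx (.inr i)) = p := by
  funext i; simp [interleave]

theorem idx_inl_injective :
    Function.Injective fun i : ℕ => idx (.inl i) :=
  idx.injective.comp Sum.inl_injective

theorem idx_inr_injective :
    Function.Injective fun i : ℕ => idx (.inr i) :=
  idx.injective.comp Sum.inr_injective

section Definable
variable {M : Model.{u, v}}

instance : Zero M.Num := ⟨M.zero⟩
instance : One M.Num := ⟨M.one⟩
instance : Add M.Num := ⟨M.add⟩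
instance : Mul M.Num := ⟨M.mul⟩
instance : LE M.Num := ⟨M.le⟩

/-- The function of the environment given by a term. -/
class DefTerm (f : (ℕ → M.Num) → M.Num) : Prop where
  out : ∃ (t : NTerm) (p : ℕ → M.Num) (E : ℕ → M.Str), ∀ e, t.eval M (interleave e p) E = f e

/-- The predicate of the environment given by a bounded formula. -/
class DefPred (S : (ℕ → M.Num) → Prop) : Prop where
  out : ∃ (φ : Formula) (p : ℕ → M.Num) (E : ℕ → M.Str), IsSigmaB0 φ ∧
    ∀ e, φ.Sat M (interleave e p) E ↔ S e

theorem DefTerm.rename {t : NTerm} {p : ℕ → M.Num} {E : ℕ → M.Str} {f : (ℕ → M.Num) → M.Num}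
    (h : ∀ e, t.eval M (interleave e p) E = f e) {g : ℕ → ℕ} {p' : ℕ → M.Num} {E' : ℕ → M.Str}
    (hp : p' ∘ g = p) (hE : E' ∘ g = E) (e : ℕ → M.Num) :
    (t.rename (mapIndex (Sum.map id g)) g).eval M (interleave e p') E' = f e := by
  rw [NTerm.eval_rename, interleave_comp_mapIndex_sumMap, hp, hE, h]

/-- Moves the parameters to other slots and leaves the bound variables alone, so that two
definitions can share one assignment of parameters. -/
theorem DefPred.rename {φ : Formula} (hφ : IsSigmaB0 φ) {p : ℕ → M.Num} {E : ℕ → M.Str}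
    {S : (ℕ → M.Num) → Prop} (h : ∀ e, φ.Sat M (interleave e p) E ↔ S e) {g : ℕ → ℕ}
    (hg : g.Injective) {p' : ℕ → M.Num} {E' : ℕ → M.Str}
    (hp : p' ∘ g = p) (hE : E' ∘ g = E) :
    IsSigmaB0 (φ.rename (mapIndex (Sum.map id g)) g) ∧ ∀ e,
    (φ.rename (mapIndex (Sum.map id g)) g).Sat M (interleave e p') E' ↔ S e := by
  have hi := mapIndex_injective (Function.injective_id.sumMap hg)
  refine ⟨hφ.rename hi, fun e => ?_⟩
  rw [hφ.sat_rename hi, interleave_comp_mapIndex_sumMap, hp, hE, h]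

/-- The two parameter lists are interleaved, and each term is renamed into its own half. -/
theorem DefTerm.pair (f g : (ℕ → M.Num) → M.Num) [hf : DefTerm f] [hg : DefTerm g] :
    ∃ (s t : NTerm) (p : ℕ → M.Num) (E : ℕ → M.Str), ∀ e,
      s.eval M (interleave e p) E = f e ∧ t.eval M (interleave e p) E = g e := by
  obtain ⟨s, p, E, hs⟩ := hf.out
  obtain ⟨t, q, F, ht⟩ := hg.out
  exact ⟨_, _, interleave p q, interleave E F, fun e =>
    ⟨DefTerm.rename hs (interleave_comp_inl p q) (interleave_comp_inl E F) e,
      DefTerm.rename ht (interleave_comp_inr p q) (interleave_comp_inr E F) e⟩⟩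

theorem DefPred.pair (S T : (ℕ → M.Num) → Prop) [hS : DefPred S] [hT : DefPred T] :
    ∃ (φ ψ : Formula) (p : ℕ → M.Num) (E : ℕ → M.Str), IsSigmaB0 φ ∧ IsSigmaB0 ψ ∧ ∀ e,
      (φ.Sat M (interleave e p) E ↔ S e) ∧ (ψ.Sat M (interleave e p) E ↔ T e) := by
  obtain ⟨φ, p, E, hφ, hs⟩ := hS.out
  obtain ⟨ψ, q, F, hψ, ht⟩ := hT.out
  have h₁ := DefPred.rename hφ hs idx_inl_injective
    (interleave_comp_inl p q) (interleave_comp_inl E F)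
  have h₂ := DefPred.rename hψ ht idx_inr_injective
    (interleave_comp_inr p q) (interleave_comp_inr E F)
  exact ⟨_, _, interleave p q, interleave E F, h₁.1, h₂.1, fun e => ⟨h₁.2 e, h₂.2 e⟩⟩

theorem DefTerm.pairPred (f : (ℕ → M.Num) → M.Num) (S : (ℕ → M.Num) → Prop)
    [hf : DefTerm f] [hS : DefPred S] :
    ∃ (t : NTerm) (φ : Formula) (p : ℕ → M.Num) (E : ℕ → M.Str), IsSigmaB0 φ ∧ ∀ e,
      t.eval M (interleave e p) E = f e ∧ (φ.Sat M (interleave e p) E ↔ S e) := by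
  obtain ⟨s, p, E, hs⟩ := hf.out
  obtain ⟨ψ, q, F, hψ, ht⟩ := hS.out
  have h₂ := DefPred.rename hψ ht idx_inr_injective
    (interleave_comp_inr p q) (interleave_comp_inr E F)
  exact ⟨_, _, interleave p q, interleave E F, h₂.1, fun e =>
    ⟨DefTerm.rename hs (interleave_comp_inl p q) (interleave_comp_inl E F) e, h₂.2 e⟩⟩

instance (i : ℕ) : DefTerm (M := M) (fun e => e i) :=
  ⟨.var (idx (.inl i)), fun _ => M.zero, fun _ => M.str_nonempty.some,
    fun e => by simp [NTerm.eval, interleave]⟩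

instance (c : M.Num) : DefTerm (M := M) (fun _ => c) :=
  ⟨.var (idx (.inr 0)), fun _ => c, fun _ => M.str_nonempty.some,
    fun e => by simp [NTerm.eval, interleave]⟩

instance (f g : (ℕ → M.Num) → M.Num) [DefTerm f] [DefTerm g] : DefTerm (fun e => f e + g e) :=
  let ⟨s, t, p, E, h⟩ := DefTerm.pair f g
  ⟨.add s t, p, E, fun e => congrArg₂ M.add (h e).1 (h e).2⟩

instance (f g : (ℕ → M.Num) → M.Num) [DefTerm f] [DefTerm g] : DefTerm (fun e => f e * g e) :=
  let ⟨s, t, p, E, h⟩ := DefTerm.pair f g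
  ⟨.mul s t, p, E, fun e => congrArg₂ M.mul (h e).1 (h e).2⟩

instance (f g : (ℕ → M.Num) → M.Num) [DefTerm f] [DefTerm g] : DefPred (fun e => f e = g e) :=
  let ⟨s, t, p, E, h⟩ := DefTerm.pair f g
  ⟨.eqN s t, p, E, .eqN _ _, fun e => by simp only [Formula.Sat, h]⟩

instance (f g : (ℕ → M.Num) → M.Num) [DefTerm f] [DefTerm g] : DefPred (fun e => f e ≤ g e) :=
  let ⟨s, t, p, E, h⟩ := DefTerm.pair f g
  ⟨.le s t, p, E, .le _ _, fun e => by simp only [Formula.Sat, h]; rfl⟩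

instance (f : (ℕ → M.Num) → M.Num) (X : M.Str) [h : DefTerm f] :
    DefPred (fun e => M.mem (f e) X) := by
  obtain ⟨t, p, E, h⟩ := h.out
  have h' := DefTerm.rename (g := fun i => idx (.inl i))
    (E' := interleave E fun _ => X) h (interleave_comp_inl p p) (interleave_comp_inl E _)
  refine ⟨.mem (t.rename (mapIndex (Sum.map id fun i => idx (.inl i))) fun i => idx (.inl i))
    (idx (.inr 0)), interleave p p, interleave E fun _ => X, .mem _ _, fun e => ?_⟩
  simp only [Formula.Sat, h']
  simp [interleave]

theorem DefPred.congr {S T : (ℕ → M.Num) → Prop} (hS : DefPred S) (h : ∀ e, T e ↔ S e) :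
    DefPred T := by
  rwa [show T = S from funext fun e => propext (h e)]

instance (S : (ℕ → M.Num) → Prop) [h : DefPred S] : DefPred (fun e => ¬ S e) :=
  let ⟨φ, p, E, hφ, h⟩ := h.out
  ⟨.neg φ, p, E, .neg hφ, fun e => not_congr (h e)⟩

instance (S T : (ℕ → M.Num) → Prop) [DefPred S] [DefPred T] : DefPred (fun e => S e ∧ T e) :=
  let ⟨φ, ψ, p, E, hφ, hψ, h⟩ := DefPred.pair S T
  ⟨.and φ ψ, p, E, .and hφ hψ, fun e => and_congr (h e).1 (h e).2⟩

instance (S T : (ℕ → M.Num) → Prop) [DefPred S] [DefPred T] : DefPred (fun e => S e ∨ T e) :=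
  let ⟨φ, ψ, p, E, hφ, hψ, h⟩ := DefPred.pair S T
  ⟨.or φ ψ, p, E, .or hφ hψ, fun e => or_congr (h e).1 (h e).2⟩

instance (S T : (ℕ → M.Num) → Prop) [DefPred S] [DefPred T] : DefPred (fun e => S e → T e) :=
  DefPred.congr (S := fun e => ¬ S e ∨ T e) inferInstance fun _ => imp_iff_not_or

instance (S T : (ℕ → M.Num) → Prop) [DefPred S] [DefPred T] : DefPred (fun e => S e ↔ T e) :=
  DefPred.congr (S := fun e => (S e → T e) ∧ (T e → S e)) inferInstance fun _ =>
    iff_iff_implies_and_implies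

/-- Excluded middle in the metatheory: a condition that ignores the environment is constantly true
or constantly false, however complex it is. -/
instance (P : Prop) : DefPred (M := M) (fun _ => P) := by
  by_cases h : P
  · exact DefPred.congr (S := fun _ => M.zero = M.zero) inferInstance fun _ => by simp [h]
  · exact DefPred.congr (S := fun _ => ¬ M.zero = M.zero) inferInstance fun _ => by simp [h]

/-- Names the innermost bound variable by a variable that is not used otherwise. -/
def bindIndex : ℕ ⊕ ℕ → ℕ ⊕ ℕ
  | .inl 0 => .inr 0
  | .inl (i + 1) => .inl i
  | .inr i => .inr (i + 1)

theorem bindIndex_injective : bindIndex.Injective := by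
  rintro ((_ | i) | i) ((_ | j) | j) h <;> simp_all [bindIndex]

/-- Assigning `a` to the freed parameter slot has the effect of pushing `a` onto the de Bruijn
environment; the old content `c` of the slot is irrelevant. -/
theorem update_interleave_comp_bindIndex {α : Type*} (e p : ℕ → α) (a c : α) :
    Function.update (interleave e (fun i => i.casesOn c p)) (idx (.inr 0)) a ∘
      mapIndex bindIndex = interleave (fun i => i.casesOn a e) p := by
  funext i
  obtain ⟨j, rfl⟩ := idx.surjective i
  rcases j with (_ | j) | j
  · simp [mapIndex, bindIndex, interleave]
  · have : idx (.inl j) ≠ idx (.inr 0) := by simp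
    simp only [Function.comp, mapIndex, Equiv.symm_apply_apply, bindIndex, interleave,
      Function.update_of_ne this]
    rfl
  · have : idx (.inr (j + 1)) ≠ idx (.inr 0) := by simp
    simp only [Function.comp, mapIndex, Equiv.symm_apply_apply, bindIndex, interleave,
      Function.update_of_ne this]
    rfl

/-- The body is read in the environment extended by the witness as index 0. The bounding term only
has its parameters shifted, so it avoids the quantified slot. -/
instance DefPred.bex (f : (ℕ → M.Num) → M.Num) (S : (ℕ → M.Num) → M.Num → Prop)
    [hf : DefTerm f] [hS : DefPred fun e => S (fun i => e (i + 1)) (e 0)] :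
    DefPred (fun e => ∃ a, a ≤ f e ∧ S e a) := by
  obtain ⟨t, φ, p, E, hφ, h⟩ := DefTerm.pairPred f fun e => S (fun i => e (i + 1)) (e 0)
  set p' : ℕ → M.Num := fun i => i.casesOn M.zero p with hp'
  set r := mapIndex (Sum.map id Nat.succ)
  have ht (e : ℕ → M.Num) (a : M.Num) : (t.rename r id).eval M
      (Function.update (interleave e p') (idx (.inr 0)) a) E = f e := by
    rw [NTerm.eval_rename, ← (h e).1]
    congr 1
    funext i
    obtain ⟨j, rfl⟩ := idx.surjective i
    have hne : r (idx j) ≠ idx (.inr 0) := by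
      rcases j with j | j <;> simp [r, mapIndex]
    simp only [Function.comp, Function.update_of_ne hne]
    rcases j with j | j <;> simp [r, mapIndex, interleave, hp']
  refine ⟨.exN (idx (.inr 0))
    (.and (.le (.var (idx (.inr 0))) (t.rename r id))
      (φ.rename (mapIndex bindIndex) id)), p', E,
    .bex (NTerm.not_occurs_rename (fun i => ?_) t)
      (hφ.rename (mapIndex_injective bindIndex_injective)), fun e => ?_⟩
  · obtain ⟨j, rfl⟩ := idx.surjective i
    rcases j with j | j <;> simp [r, mapIndex]
  · simp only [Formula.Sat, ht, hφ.sat_rename (mapIndex_injective bindIndex_injective)]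
    refine exists_congr fun a => and_congr ?_ ?_
    · simp only [NTerm.eval, Function.update_self]; rfl
    · rw [hp', update_interleave_comp_bindIndex]
      exact (h _).2

instance DefPred.ball (f : (ℕ → M.Num) → M.Num) (S : (ℕ → M.Num) → M.Num → Prop)
    [hf : DefTerm f] [hS : DefPred fun e => S (fun i => e (i + 1)) (e 0)] :
    DefPred (fun e => ∀ a, a ≤ f e → S e a) :=
  DefPred.congr (S := fun e => ¬ ∃ a, a ≤ f e ∧ ¬ S e a) inferInstance fun _ => by
    push Not; rfl

/-- Weakening: the term can be used under one more quantifier. -/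
theorem DefTerm.shift {f : (ℕ → M.Num) → M.Num} (hf : DefTerm f) :
    DefTerm fun e => f fun i => e (i + 1) := by
  obtain ⟨t, p, E, h⟩ := hf.out
  refine ⟨t.rename (mapIndex (Sum.map Nat.succ id)) id, p, E, fun e => ?_⟩
  rw [NTerm.eval_rename, ← h]
  congr 1
  funext i
  obtain ⟨j, rfl⟩ := idx.surjective i
  rcases j with j | j <;> simp [mapIndex, interleave]

end Definable

/-! ### Numbers of a model: 2-BASIC, comprehension, induction, ordered semiring -/

section Arithmetic
variable {M : Model.{u, v}}

/-- The structure is a model of `V#L`. -/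
class IsModel (M : Model.{u, v}) : Prop where
  models : M.Models theory

section Axioms
variable [hM : IsModel M]

theorem basic_axioms : (∀ x : M.Num, x + 1 ≠ 0) ∧ (∀ x y : M.Num, x + 1 = y + 1 → x = y) ∧
    (∀ x : M.Num, x + 0 = x) ∧ (∀ x y : M.Num, x + (y + 1) = (x + y) + 1) ∧
    (∀ x : M.Num, x * 0 = 0) ∧ (∀ x y : M.Num, x * (y + 1) = (x * y) + x) ∧
    (∀ x y : M.Num, x ≤ y ∧ y ≤ x → x = y) ∧ (∀ x y : M.Num, x ≤ x + y) ∧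
    (∀ x : M.Num, 0 ≤ x) ∧ (∀ x y : M.Num, x ≤ y ∨ y ≤ x) ∧
    (∀ x y : M.Num, x ≤ y ↔ (x ≤ y + 1 ∧ x ≠ y + 1)) ∧
    (∀ x : M.Num, x ≠ 0 → ∃ y, y ≤ x ∧ y + 1 = x) ∧
    (∀ (y : M.Num) X, M.mem y X → y ≤ M.len X ∧ y ≠ M.len X) ∧
    (∀ (y : M.Num) X, y + 1 = M.len X → M.mem y X) ∧
    (∀ X Y, M.len X = M.len Y ∧
      (∀ x : M.Num, x ≤ M.len X ∧ x ≠ M.len X → (M.mem x X ↔ M.mem x Y)) → X = Y) := by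
  have H : ∀ φ ∈ basic, ∀ (e : ℕ → M.Num) (E : ℕ → M.Str), φ.Sat M e E := fun φ hφ =>
    hM.models φ (.inl (.inl hφ))
  simp only [basic, Set.mem_insert_iff, forall_eq_or_imp, forall_eq, Set.mem_singleton_iff] at H
  obtain ⟨h1, h2, h3, h4, h5, h6, h7, h8, h9, h10, h11, h12, h13, h14, h15⟩ := H
  let E : ℕ → M.Str := fun _ => M.str_nonempty.some
  let e (x y : M.Num) : ℕ → M.Num := fun i => i.casesOn x fun _ => y
  let E' (x y : M.Str) : ℕ → M.Str := fun i => i.casesOn x fun _ => y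
  refine ⟨fun x => h1 (e x x) E, fun x y => imp_iff_not_or.2 (h2 (e x y) E), fun x => h3 (e x x) E,
    fun x y => h4 (e x y) E, fun x => h5 (e x x) E, fun x y => h6 (e x y) E,
    fun x y => imp_iff_not_or.2 (h7 (e x y) E), fun x y => h8 (e x y) E,
    fun x => h9 (e x x) E, fun x y => h10 (e x y) E,
    fun x y => ⟨imp_iff_not_or.2 (h11 (e x y) E).1, imp_iff_not_or.2 (h11 (e x y) E).2⟩,
    fun x => imp_iff_not_or.2 (h12 (e x x) E),
    fun x X => imp_iff_not_or.2 (h13 (e x x) (E' X X)),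
    fun x X => imp_iff_not_or.2 (h14 (e x x) (E' X X)),
    fun X Y h => imp_iff_not_or.2 (h15 (e 0 0) (E' X Y)) ⟨h.1, fun x => ?_⟩⟩
  have := h.2 x
  rw [imp_iff_not_or, iff_iff_implies_and_implies, imp_iff_not_or, imp_iff_not_or] at this
  exact this

/-- Comprehension for predicates with parameters, without reference to syntax. -/
theorem comprehension_axiom (S : M.Num → Prop) [hS : DefPred fun e => S (e 0)] (y : M.Num) :
    ∃ X, M.len X ≤ y ∧ ∀ x, x ≤ y → x ≠ y → (M.mem x X ↔ S x) := by
  obtain ⟨φ, p, E, hφ, h⟩ := hS.out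
  -- Shifting number parameters frees a slot for the bound `y`; shifting string variables makes
  -- string variable 0 not free in the formula.
  set f := mapIndex (Sum.map id Nat.succ)
  have hf : f.Injective := mapIndex_injective (Function.injective_id.sumMap Nat.succ_injective)
  have hne : idx (.inl 0) ≠ idx (.inr 0) := by simp
  have := hM.models (compAxiom (φ.rename f Nat.succ) (idx (.inl 0)) (idx (.inr 0)) 0)
    (.inl (.inr ⟨_, _, _, _, hφ.rename hf, hne, Formula.not_freeStr_rename (by simp) _, rfl⟩))
    (interleave (fun _ => 0) (fun i => i.casesOn y p)) (fun i => i.casesOn M.str_nonempty.some E)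
  obtain ⟨X, hX, hX'⟩ := this
  have hy : interleave (fun _ => (0 : M.Num)) (fun i => i.casesOn y p) (idx (.inr 0)) = y := by
    simp [interleave]
  refine ⟨X, ?_, fun x hxy hxy' => ?_⟩
  · simp only [Formula.Sat, NTerm.eval, Function.update_self, hy] at hX
    exact hX
  have := hX' x
  simp only [Formula.imp, Formula.iff, Formula.lt, Formula.Sat, NTerm.eval, Function.update_self,
    Function.update_of_ne hne.symm, hy] at this
  have h0 := (this.resolve_left (not_not.2 ⟨hxy, hxy'⟩))
  rw [← imp_iff_not_or, ← imp_iff_not_or, ← iff_iff_implies_and_implies,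
    hφ.sat_rename hf] at h0
  have he : interleave (Function.update (fun _ => (0 : M.Num)) 0 x) p =
      Function.update (interleave (fun _ => (0 : M.Num)) (fun i => i.casesOn y p))
        (idx (.inl 0)) x ∘ f := by
    funext i
    obtain ⟨(_ | j) | j, rfl⟩ := idx.surjective i <;>
      simp [f, mapIndex, interleave, Function.update]
  refine h0.trans ((iff_of_eq ?_).trans (h (Function.update (fun _ => (0 : M.Num)) 0 x)))
  rw [he]
  rfl

/-- The length of a nonempty string is one more than its greatest element. For X = {x ≤ a : S x}, a
greatest element w < a is impossible, since S (w + 1) would put w + 1 into X. -/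
theorem num_induction {S : M.Num → Prop} [DefPred fun e => S (e 0)] (h0 : S 0)
    (h : ∀ x, S x → S (x + 1)) (a : M.Num) : S a := by
  obtain ⟨-, -, hzero, -, -, -, anti, hle, -, total, hlt, pred, len_lt, len_mem, -⟩ :=
    basic_axioms (M := M)
  have refl (x : M.Num) : x ≤ x := by simpa only [hzero] using hle x 0
  obtain ⟨X, hX, hX'⟩ := comprehension_axiom S (a + 1)
  have h0X : M.mem 0 X := (hX' 0 ((hlt 0 a).1 (basic_axioms.2.2.2.2.2.2.2.2.1 a)).1
    ((hlt 0 a).1 (basic_axioms.2.2.2.2.2.2.2.2.1 a)).2).2 h0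
  obtain ⟨w, -, hw⟩ := pred (M.len X) fun h =>
    (len_lt 0 X h0X).2 (anti _ _ ⟨(len_lt 0 X h0X).1, h ▸ refl _⟩)
  have hwX := len_mem w X hw
  have hwa : w ≤ a := by
    refine (total w a).elim id fun haw => ?_
    rw [← hw] at hX
    have h1 := (hlt a w).1 haw
    by_cases h2 : w + 1 = a + 1
    · rw [basic_axioms.2.1 _ _ h2]
      exact refl _
    · exact absurd (anti _ _ ⟨h1.1, (hlt _ _).2 ⟨hX, h2⟩⟩) h1.2
  have hSw : S (w + 1) := h w ((hX' w ((hlt _ _).1 hwa).1 ((hlt _ _).1 hwa).2).1 hwX)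
  by_cases hwa' : w + 1 ≤ a
  · have := (hX' (w + 1) ((hlt _ _).1 hwa').1 ((hlt _ _).1 hwa').2).2 hSw
    exact absurd hw (len_lt _ _ this).2
  · have h1 : a ≤ w + 1 := (total _ _).resolve_left hwa'
    have h2 : a ≠ w + 1 := fun h => hwa' (h ▸ refl _)
    have h3 : a = w := anti _ _ ⟨(hlt _ _).2 ⟨h1, h2⟩, hwa⟩
    exact h3 ▸ (hX' w ((hlt _ _).1 hwa).1 ((hlt _ _).1 hwa).2).1 hwX

theorem num_zero_add (x : M.Num) : 0 + x = x := by
  obtain ⟨-, -, h3, h4, -⟩ := basic_axioms (M := M)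
  exact num_induction (S := fun x => 0 + x = x) (h3 0) (fun x hx => by rw [h4, hx]) x

theorem num_succ_add (x y : M.Num) : x + 1 + y = x + y + 1 := by
  obtain ⟨-, -, h3, h4, -⟩ := basic_axioms (M := M)
  exact num_induction (S := fun y => x + 1 + y = x + y + 1) (by rw [h3, h3])
    (fun y hy => by rw [h4, hy, h4]) y

theorem num_add_comm (x y : M.Num) : x + y = y + x := by
  obtain ⟨-, -, h3, h4, -⟩ := basic_axioms (M := M)
  exact num_induction (S := fun y => x + y = y + x) (by rw [h3, num_zero_add])
    (fun y hy => by rw [h4, hy, num_succ_add]) y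

theorem num_add_assoc (x y z : M.Num) : x + y + z = x + (y + z) := by
  obtain ⟨-, -, h3, h4, -⟩ := basic_axioms (M := M)
  exact num_induction (S := fun z => x + y + z = x + (y + z)) (by rw [h3, h3])
    (fun y hy => by rw [h4, hy, h4, h4]) z

theorem num_zero_mul (x : M.Num) : 0 * x = 0 := by
  obtain ⟨-, -, h3, h4, h5, h6, -⟩ := basic_axioms (M := M)
  exact num_induction (S := fun x => 0 * x = 0) (h5 0) (fun x hx => by rw [h6, hx, h3]) x

theorem num_succ_mul (x y : M.Num) : (x + 1) * y = x * y + y := by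
  obtain ⟨-, -, h3, h4, h5, h6, -⟩ := basic_axioms (M := M)
  exact num_induction (S := fun y => (x + 1) * y = x * y + y) (by rw [h5, h5, h3])
    (fun y hy => by
      rw [h6, hy, h6, num_add_assoc, num_add_assoc, ← num_add_assoc y, num_add_comm y x,
        num_add_assoc x]) y

theorem num_mul_comm (x y : M.Num) : x * y = y * x := by
  obtain ⟨-, -, h3, h4, h5, h6, -⟩ := basic_axioms (M := M)
  exact num_induction (S := fun y => x * y = y * x) (by rw [h5, num_zero_mul])
    (fun y hy => by rw [h6, hy, num_succ_mul]) y

theorem num_mul_add (x y z : M.Num) : x * (y + z) = x * y + x * z := by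
  obtain ⟨-, -, h3, h4, h5, h6, -⟩ := basic_axioms (M := M)
  exact num_induction (S := fun z => x * (y + z) = x * y + x * z) (by rw [h3, h5, h3])
    (fun z hz => by rw [h4, h6, hz, h6, num_add_assoc]) z

theorem num_mul_assoc (x y z : M.Num) : x * y * z = x * (y * z) := by
  obtain ⟨-, -, h3, h4, h5, h6, -⟩ := basic_axioms (M := M)
  exact num_induction (S := fun z => x * y * z = x * (y * z)) (by rw [h5, h5, h5])
    (fun z hz => by rw [h6, hz, h6, num_mul_add]) z

theorem num_mul_one (x : M.Num) : x * 1 = x := by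
  obtain ⟨-, -, h3, h4, h5, h6, -⟩ := basic_axioms (M := M)
  rw [← num_zero_add 1, h6, h5, num_zero_add]

instance : CommSemiring M.Num where
  add_assoc := num_add_assoc
  zero_add := num_zero_add
  add_zero := basic_axioms.2.2.1
  add_comm := num_add_comm
  left_distrib := num_mul_add
  right_distrib x y z := by rw [num_mul_comm, num_mul_add, num_mul_comm z, num_mul_comm z]
  zero_mul := num_zero_mul
  mul_zero x := by rw [num_mul_comm, num_zero_mul]
  mul_assoc := num_mul_assoc
  one_mul x := by rw [num_mul_comm, num_mul_one]
  mul_one := num_mul_one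
  mul_comm := num_mul_comm
  nsmul := nsmulRec

theorem num_le_iff_exists_add {x y : M.Num} : x ≤ y ↔ ∃ z, y = x + z := by
  obtain ⟨-, -, -, -, -, -, anti, hle, hpos, total, hlt, -⟩ := basic_axioms (M := M)
  refine ⟨fun h => ?_, fun ⟨z, hz⟩ => hz ▸ hle x z⟩
  have : ∀ y, x ≤ y → ∃ z, z ≤ y ∧ y = x + z := fun y => by
    -- The bound `z ≤ y` is there only to make the induction formula bounded.
    refine num_induction (S := fun y => x ≤ y → ∃ z, z ≤ y ∧ y = x + z)
      (fun h => ⟨0, hpos 0, ?_⟩) (fun y ih h => ?_) y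
    · rw [add_zero]; exact anti _ _ ⟨hpos _, h⟩
    · by_cases hxy : x = y + 1
      · exact ⟨0, hpos _, by rw [add_zero, hxy]⟩
      · obtain ⟨z, -, hz⟩ := ih ((hlt _ _).2 ⟨h, hxy⟩)
        exact ⟨z + 1, by rw [hz, add_assoc, add_comm x]; exact hle _ _, by rw [hz, add_assoc]⟩
  obtain ⟨z, -, hz⟩ := this y h
  exact ⟨z, hz⟩

theorem num_add_right_cancel {x y z : M.Num} : x + z = y + z → x = y :=
  num_induction (S := fun z => x + z = y + z → x = y) (by simp) (fun z ih h =>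
    ih (basic_axioms.2.1 _ _ (by rwa [add_assoc, add_assoc]))) z

open Classical in
noncomputable instance : LinearOrder M.Num where
  le_refl x := num_le_iff_exists_add.2 ⟨0, by simp⟩
  le_trans x y z h h' := by
    obtain ⟨a, rfl⟩ := num_le_iff_exists_add.1 h
    obtain ⟨b, rfl⟩ := num_le_iff_exists_add.1 h'
    exact num_le_iff_exists_add.2 ⟨a + b, by rw [add_assoc]⟩
  le_antisymm x y h h' := basic_axioms.2.2.2.2.2.2.1 x y ⟨h, h'⟩
  le_total := basic_axioms.2.2.2.2.2.2.2.2.2.1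
  toDecidableLE := Classical.decRel _

theorem num_eq_zero_or_succ (x : M.Num) : x = 0 ∨ ∃ y, x = y + 1 :=
  or_iff_not_imp_left.2 fun h => let ⟨y, _, hy⟩ := basic_axioms.2.2.2.2.2.2.2.2.2.2.2.1 x h
    ⟨y, hy.symm⟩

theorem num_zero_le (x : M.Num) : 0 ≤ x := basic_axioms.2.2.2.2.2.2.2.2.1 x

theorem num_mul_lt_mul {a b c : M.Num} (hab : a < b) (hc : 0 < c) : c * a < c * b := by
  obtain ⟨z, rfl⟩ := num_le_iff_exists_add.1 hab.le
  obtain rfl | ⟨z, rfl⟩ := num_eq_zero_or_succ z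
  · simp at hab
  obtain rfl | ⟨c, rfl⟩ := num_eq_zero_or_succ c
  · simp at hc
  refine lt_of_le_of_ne (num_le_iff_exists_add.2 ⟨(c + 1) * (z + 1), by ring⟩) fun h => ?_
  have h1 : 0 + (c + 1) * a = (c * z + c + z + 1) + (c + 1) * a := by
    rw [zero_add]; refine h.trans ?_; ring
  exact basic_axioms.1 _ (num_add_right_cancel h1).symm

instance : IsStrictOrderedRing M.Num where
  add_le_add_left _ _ h _ := by
    obtain ⟨a, rfl⟩ := num_le_iff_exists_add.1 h
    exact num_le_iff_exists_add.2 ⟨a, by ring⟩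
  le_of_add_le_add_left x _ _ h := by
    obtain ⟨a, ha⟩ := num_le_iff_exists_add.1 h
    exact num_le_iff_exists_add.2 ⟨a, num_add_right_cancel (z := x) (by rw [add_comm, ha]; ring)⟩
  zero_le_one := num_zero_le 1
  exists_pair_ne := ⟨0, 1, fun h => (basic_axioms (M := M)).1 0 (by rw [zero_add]; exact h.symm)⟩
  mul_lt_mul_of_pos_left a ha b c h := num_mul_lt_mul h ha
  mul_lt_mul_of_pos_right a ha b c h := by
    rw [mul_comm b, mul_comm c]; exact num_mul_lt_mul h ha

instance : CanonicallyOrderedAdd M.Num where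
  exists_add_of_le h := num_le_iff_exists_add.1 h
  le_self_add x y := num_le_iff_exists_add.2 ⟨y, rfl⟩
  le_add_self x y := num_le_iff_exists_add.2 ⟨y, add_comm _ _⟩

theorem num_lt_succ_iff {x y : M.Num} : x < y + 1 ↔ x ≤ y :=
  lt_iff_le_and_ne.trans (basic_axioms.2.2.2.2.2.2.2.2.2.2.1 x y).symm

theorem num_succ_le_iff {x y : M.Num} : x + 1 ≤ y ↔ x < y := by
  rw [← not_lt, num_lt_succ_iff, not_le]

instance (f g : (ℕ → M.Num) → M.Num) [DefTerm f] [DefTerm g] : DefPred (fun e => f e < g e) :=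
  DefPred.congr (S := fun e => ¬ g e ≤ f e) inferInstance fun _ => not_le.symm

instance DefPred.bex_lt (f : (ℕ → M.Num) → M.Num) (S : (ℕ → M.Num) → M.Num → Prop)
    [hf : DefTerm f] [hS : DefPred fun e => S (fun i => e (i + 1)) (e 0)] :
    DefPred (fun e => ∃ a, a < f e ∧ S e a) :=
  DefPred.congr (S := fun e => ∃ a, a ≤ f e ∧ (¬ f e ≤ a) ∧ S e a)
    (have := hf.shift; inferInstance) fun e => by
    refine exists_congr fun a => ?_
    rw [← and_assoc, not_le]
    exact and_congr_left fun _ => ⟨fun h => ⟨h.le, h⟩, And.right⟩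

instance DefPred.ball_lt (f : (ℕ → M.Num) → M.Num) (S : (ℕ → M.Num) → M.Num → Prop)
    [hf : DefTerm f] [hS : DefPred fun e => S (fun i => e (i + 1)) (e 0)] :
    DefPred (fun e => ∀ a, a < f e → S e a) :=
  DefPred.congr (S := fun e => ¬ ∃ a, a < f e ∧ ¬ S e a)
    (have := hf.shift; inferInstance) fun _ => by
    push Not; rfl

end Axioms
end Arithmetic

/-! ### The meaning of the formulas in a structure -/

section Semantics
variable {M : Model.{u, v}}

/-- These connectives copy the shape of `Formula.imp`, `Formula.iff` and `Formula.xor` under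
`Formula.Sat`. The predicates built from them therefore agree with satisfaction by definition, and
`Iff.rfl` proves `sat_matrixPowering` and `sat_pfBlockIdentity`. -/
def impP (a b : Prop) : Prop := ¬ a ∨ b
def iffP (a b : Prop) : Prop := impP a b ∧ impP b a
def xorP (a b : Prop) : Prop := ¬ iffP a b

@[simp] theorem impP_iff {a b : Prop} : impP a b ↔ (a → b) := imp_iff_not_or.symm
@[simp] theorem iffP_iff {a b : Prop} : iffP a b ↔ (a ↔ b) := by
  rw [iffP, impP_iff, impP_iff, ← iff_iff_implies_and_implies]
@[simp] theorem xorP_iff {a b : Prop} : xorP a b ↔ ¬ (a ↔ b) := not_congr iffP_iff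

def ltP (x y : M.Num) : Prop := x ≤ y ∧ ¬ x = y

/-- The meaning of a bit predicate. -/
abbrev BitSet (M : Model.{u, v}) : Type u := M.Num → Prop
abbrev Matr (M : Model.{u, v}) : Type u := M.Num → M.Num → BitSet M

def eqBitsP (b c : BitSet M) : Prop := ∀ i, iffP (b i) (c i)
def emptyBitsP (b : BitSet M) : Prop := ∀ i, ¬ b i

def carryP (b c : BitSet M) (i : M.Num) : Prop :=
  ∃ k, ltP k i ∧ b k ∧ c k ∧ ∀ j, impP (ltP k j ∧ ltP j i) (b j ∨ c j)

def natAddP (b c d : BitSet M) : Prop :=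
  ∀ i, iffP (d i) (xorP (xorP (b i) (c i)) (carryP b c i))

def shiftP (s : M.Num) (b : BitSet M) : BitSet M := fun j => ∃ t, t + s = j ∧ b t

def pairP (x y : M.Num) : M.Num := (x + y) * (x + y + 1) + (1 + 1) * y
def rowP (W : M.Str) (l : M.Num) : BitSet M := fun i => M.mem (pairP l i) W

def natMulP (b c d : BitSet M) : Prop :=
  ∃ l : M.Num, (∀ i, impP (c i) (ltP i l)) ∧ ∃ W : M.Str,
    emptyBitsP (rowP W 0) ∧
    (∀ i, impP (ltP i l)
      (impP (c i) (natAddP (rowP W i) (shiftP i b) (rowP W (i + 1))) ∧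
      impP (¬ c i) (eqBitsP (rowP W (i + 1)) (rowP W i)))) ∧
    eqBitsP (rowP W l) d

def signP (b : BitSet M) : Prop := b 0
def magP (b : BitSet M) : BitSet M := fun i => b (i + 1)
def nonzeroP (b : BitSet M) : Prop := ∃ i, magP b i
def isIntP (b : BitSet M) : Prop := impP (signP b) (nonzeroP b)
def isZeroP (b : BitSet M) : Prop := emptyBitsP b
def isOneP (b : BitSet M) : Prop := ∀ i, iffP (b i) (i = 1)
def isNegOneP (b : BitSet M) : Prop := ∀ i, iffP (b i) (i = 0 ∨ i = 1)

def intAddP (b c d : BitSet M) : Prop :=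
  isIntP d ∧
  (((iffP (signP b) (signP c) ∧ iffP (signP d) (signP b) ∧ natAddP (magP b) (magP c) (magP d))) ∨
   (xorP (signP b) (signP c) ∧
     ((iffP (signP d) (signP b) ∧ natAddP (magP c) (magP d) (magP b)) ∨
      (iffP (signP d) (signP c) ∧ natAddP (magP b) (magP d) (magP c)))))

def intMulP (b c d : BitSet M) : Prop :=
  isIntP d ∧ natMulP (magP b) (magP c) (magP d) ∧
    impP (nonzeroP d) (iffP (signP d) (xorP (signP b) (signP c)))

def matP (X : M.Str) : Matr M := fun a b i => M.mem (pairP (pairP a b) i) X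
def matsP (P : M.Str) (k : M.Num) : Matr M := fun a b i => M.mem (pairP (pairP (pairP k a) b) i) P
def blockP (A : Matr M) (s t : M.Num) : Matr M := fun a b => A (s + a) (t + b)

def isMatP (p q : M.Num) (A : Matr M) : Prop :=
  ∀ a b, impP (ltP a p ∧ ltP b q) (isIntP (A a b))
def eqMatP (p q : M.Num) (A B : Matr M) : Prop :=
  ∀ a b, impP (ltP a p ∧ ltP b q) (eqBitsP (A a b) (B a b))
def isIdP (m : M.Num) (A : Matr M) : Prop :=
  ∀ a b, impP (ltP a m ∧ ltP b m)
    (impP (a = b) (isOneP (A a b)) ∧ impP (¬ a = b) (isZeroP (A a b)))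

def dotP (q : M.Num) (A B : Matr M) (a b : M.Num) (d : BitSet M) : Prop :=
  ∃ T : M.Str, isZeroP (rowP T 0) ∧
    (∀ l, impP (ltP l q) (∃ V : M.Str,
      intMulP (A a l) (B l b) (fun i => M.mem i V) ∧
      intAddP (rowP T l) (fun i => M.mem i V) (rowP T (l + 1)))) ∧
    eqBitsP (rowP T q) d

def matMulP (p q r : M.Num) (A B C : Matr M) : Prop :=
  ∀ a b, impP (ltP a p ∧ ltP b r) (dotP q A B a b (C a b))

def matPowP (m : M.Num) (A : Matr M) (n : M.Num) (B : Matr M) : Prop :=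
  ∃ P : M.Str, isIdP m (matsP P 0) ∧
    (∀ k, impP (ltP k n) (matMulP m m m (matsP P k) A (matsP P (k + 1)))) ∧
    eqMatP m m (matsP P n) B

def upperP (a b : M.Num) : Prop := ∃ t, a = t + t ∧ b = t + t + 1

def isJP (m : M.Num) (A : Matr M) : Prop :=
  ∀ a b, impP (ltP a m ∧ ltP b m)
    (impP (upperP a b) (isOneP (A a b)) ∧ impP (upperP b a) (isNegOneP (A a b)) ∧
    impP (¬ upperP a b ∧ ¬ upperP b a) (isZeroP (A a b)))

def pbCoeffP (m : M.Num) (R N S : Matr M) (r : M.Num) (z : BitSet M) : Prop :=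
  ∃ J MJ P RJ U : M.Str,
    isJP m (matP J) ∧ matMulP m m m N (matP J) (matP MJ) ∧ matPowP m (matP MJ) r (matP P) ∧
    matMulP 1 m m R (matP J) (matP RJ) ∧ matMulP 1 m m (matP RJ) (matP P) (matP U) ∧
    dotP m (matP U) S 0 0 z

def isPBMatrixP (d : M.Num) (A P : Matr M) : Prop :=
  ∀ i j, impP (ltP i (d + 1 + 1) ∧ ltP j (d + 1))
    (impP (ltP i j) (isZeroP (P i j)) ∧ impP (i = j) (isOneP (P i j)) ∧
    impP (i = j + 1) (eqBitsP (P i j) (A 0 1)) ∧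
    (∀ r, impP (i = j + 1 + 1 + r)
      (pbCoeffP (d + d) (blockP A 0 (1 + 1)) (blockP A (1 + 1) (1 + 1)) (blockP A (1 + 1) 1) r
        (P i j))))

def pfaffianP (N : M.Num) (A : Matr M) (z : BitSet M) : Prop :=
  ∃ Q : M.Str, isOneP (matP Q N 0) ∧
    (∀ k d, impP (k + d + 1 = N) (∃ P : M.Str,
      isPBMatrixP d (blockP A (k + k) (k + k)) (matP P) ∧
      matMulP (d + 1 + 1) (d + 1) 1 (matP P)
        (fun j _ => matP Q (k + 1) j) (fun i _ => matP Q k i))) ∧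
    eqBitsP (matP Q 0 N) z

def isBlockIdentityP (N : M.Num) (A : Matr M) : Prop :=
  ∀ a b, impP (ltP a (N + N) ∧ ltP b (N + N))
    (impP (b = a + N) (isOneP (A a b)) ∧ impP (a = b + N) (isNegOneP (A a b)) ∧
    impP (¬ b = a + N ∧ ¬ a = b + N) (isZeroP (A a b)))

def isNegOnePowP (n : M.Num) (z : BitSet M) : Prop :=
  ((∃ t, n = t + t) ∧ isOneP z) ∨ ((∃ t, n = t + t + 1) ∧ isNegOneP z)

theorem sat_matrixPowering (e : ℕ → M.Num) (E : ℕ → M.Str) :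
    matrixPowering.Sat M e E ↔ ∀ (m n : M.Num) X, impP (isMatP m m (matP X))
      (∃ Y, matPowP m (matP X) n (matP Y)) := Iff.rfl

theorem sat_pfBlockIdentity (e : ℕ → M.Num) (E : ℕ → M.Str) :
    pfBlockIdentity.Sat M e E ↔ ∀ n : M.Num, (∃ A, isBlockIdentityP (n + n) (matP A)) ∧
      ∀ A, impP (isBlockIdentityP (n + n) (matP A))
        ((∃ Z, pfaffianP (n + n) (matP A) (M.mem · Z)) ∧
        ∀ Z, impP (pfaffianP (n + n) (matP A) (M.mem · Z)) (isNegOnePowP n (M.mem · Z))) := Iff.rfl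

end Semantics

/-! ### Coding of sets and arrays by strings -/

section Coding
variable {M : Model.{u, v}} [hM : IsModel M]

@[simp] theorem ltP_iff {x y : M.Num} : ltP x y ↔ x < y := lt_iff_le_and_ne.symm

theorem mem_lt_len {i : M.Num} {X : M.Str} (h : M.mem i X) : i < M.len X :=
  lt_iff_le_and_ne.2 (basic_axioms.2.2.2.2.2.2.2.2.2.2.2.2.1 i X h)

/-! ### The pairing function -/

instance (f g : (ℕ → M.Num) → M.Num) [DefTerm f] [DefTerm g] :
    DefTerm (fun e => pairP (f e) (g e)) := by
  unfold pairP; infer_instance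

theorem pairP_le_pairP {a b c d : M.Num} (h : a ≤ c) (h' : b ≤ d) : pairP a b ≤ pairP c d := by
  unfold pairP; gcongr

theorem le_pairP_right (a b : M.Num) : b ≤ pairP a b :=
  num_le_iff_exists_add.2 ⟨(a + b) * (a + b) + a + (1 + 1) * b, by unfold pairP; ring⟩

theorem num_ne_add_succ (x y : M.Num) : x ≠ x + (y + 1) := fun h =>
  basic_axioms.1 y (num_add_right_cancel (z := x) (by rw [zero_add, add_comm, ← h]))

/-- From a sum s to a larger one, s(s+1) grows by at least 2s + 2, which exceeds the summand 2b
because b ≤ s. -/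
theorem pairP_ne_of_lt {a b c d : M.Num} (h : a + b < c + d) : pairP a b ≠ pairP c d := by
  obtain ⟨z, hz⟩ := num_le_iff_exists_add.1 (num_succ_le_iff.2 h)
  intro h
  refine num_ne_add_succ (pairP a b) (1 + 2 * a + z * (a + b + 1 + 1 + z) + (a + b + 1) * z + 2 * d) ?_
  conv_lhs => rw [h]
  unfold pairP
  rw [hz]
  ring

theorem pairP_inj {a b c d : M.Num} : pairP a b = pairP c d ↔ a = c ∧ b = d := by
  refine ⟨fun h => ?_, fun h => by rw [h.1, h.2]⟩
  have hs : a + b = c + d := le_antisymm (not_lt.1 fun h' => pairP_ne_of_lt h' h.symm)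
    (not_lt.1 fun h' => pairP_ne_of_lt h' h)
  have hb : b = d := by
    have h' : (1 + 1) * b = (1 + 1) * d := by
      unfold pairP at h
      rw [hs] at h
      exact add_left_cancel h
    exact mul_left_cancel₀ (by positivity) h'
  subst hb
  exact ⟨add_right_cancel hs, rfl⟩

/-! ### Sets that are given by strings -/

/-- The set is the set of elements of a string. -/
class Code (b : BitSet M) : Prop where
  out : ∃ X, ∀ i, M.mem i X ↔ b i

theorem Code.of_bounded {b : BitSet M} [DefPred fun e => b (e 0)] (s : M.Num)
    (hs : ∀ i, b i → i < s) : Code b := by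
  obtain ⟨X, hX, h⟩ := comprehension_axiom b s
  refine ⟨X, fun i => ⟨fun hi => ?_, fun hi => ?_⟩⟩
  · have := (mem_lt_len hi).trans_le hX
    exact (h i this.le this.ne).1 hi
  · exact (h i (hs i hi).le (hs i hi).ne).2 hi

theorem Code.exists_eq (b : BitSet M) [h : Code b] : ∃ X, b = fun i => M.mem i X :=
  let ⟨X, hX⟩ := h.out
  ⟨X, funext fun i => propext (hX i).symm⟩

theorem Code.bounded (b : BitSet M) [h : Code b] : ∃ s, ∀ i, b i → i < s :=
  let ⟨X, hX⟩ := h.out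
  ⟨M.len X, fun i hi => mem_lt_len ((hX i).2 hi)⟩

instance (X : M.Str) : Code (fun i => M.mem i X) := ⟨X, fun _ => Iff.rfl⟩

instance (b : BitSet M) [Code b] (f : (ℕ → M.Num) → M.Num) [DefTerm f] :
    DefPred (fun e => b (f e)) := by
  obtain ⟨X, rfl⟩ := Code.exists_eq b
  infer_instance

/-- The predecessor of the length is an element, by the axiom on lengths. -/
theorem Code.exists_max {b : BitSet M} [hb : Code b] {i : M.Num} (hi : b i) :
    ∃ k, b k ∧ ∀ j, b j → j ≤ k := by
  obtain ⟨X, rfl⟩ := Code.exists_eq b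
  obtain h | ⟨k, hk⟩ := num_eq_zero_or_succ (M.len X)
  · exact absurd (mem_lt_len hi) (h ▸ not_lt.2 (num_zero_le i))
  · exact ⟨k, basic_axioms.2.2.2.2.2.2.2.2.2.2.2.2.2.1 k X hk.symm, fun j hj =>
      num_lt_succ_iff.1 (hk ▸ mem_lt_len hj)⟩

instance (b c : BitSet M) [Code b] [Code c] : Code (fun i => b i ∨ c i) := by
  obtain ⟨s, hs⟩ := Code.bounded b
  obtain ⟨t, ht⟩ := Code.bounded c
  exact Code.of_bounded (max s t) fun i hi =>
    hi.elim (fun h => (hs i h).trans_le (le_max_left _ _)) fun h =>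
      (ht i h).trans_le (le_max_right _ _)

def zeroB : BitSet M := fun _ => False
def oneB : BitSet M := fun i => i = 1
def negOneB : BitSet M := fun i => i = 0 ∨ i = 1

instance : Code (zeroB (M := M)) := Code.of_bounded (b := fun _ => False) 0 fun _ => False.elim
instance : Code (oneB (M := M)) := Code.of_bounded (b := fun i => i = 1) (1 + 1) fun i hi =>
  num_lt_succ_iff.2 hi.le
instance : Code (negOneB (M := M)) :=
  Code.of_bounded (b := fun i => i = 0 ∨ i = 1) (1 + 1) fun i hi =>
    num_lt_succ_iff.2 (hi.elim (fun h => h ▸ num_zero_le 1) fun h => h.le)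

instance (W : M.Str) (f g : (ℕ → M.Num) → M.Num) [DefTerm f] [DefTerm g] :
    DefPred fun e => rowP W (f e) (g e) := by
  unfold rowP; infer_instance

instance (W : M.Str) (f g h : (ℕ → M.Num) → M.Num) [DefTerm f] [DefTerm g] [DefTerm h] :
    DefPred fun e => matP W (f e) (g e) (h e) := by
  unfold matP; infer_instance

instance (W : M.Str) (k f g h : (ℕ → M.Num) → M.Num) [DefTerm k] [DefTerm f] [DefTerm g]
    [DefTerm h] : DefPred fun e => matsP W (k e) (f e) (g e) (h e) := by
  unfold matsP; infer_instance

theorem rowP_lt_len {W : M.Str} {l i : M.Num} (h : rowP W l i) : i < M.len W :=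
  (le_pairP_right l i).trans_lt (mem_lt_len h)

theorem matP_lt_len {W : M.Str} {a b i : M.Num} (h : matP W a b i) : i < M.len W :=
  rowP_lt_len (l := pairP a b) h

theorem matsP_lt_len {W : M.Str} {k a b i : M.Num} (h : matsP W k a b i) : i < M.len W :=
  rowP_lt_len (l := pairP (pairP k a) b) h

instance (W : M.Str) (l : M.Num) : Code (rowP W l) :=
  Code.of_bounded (M.len W) fun _ => rowP_lt_len
instance (W : M.Str) (a b : M.Num) : Code (matP W a b) :=
  Code.of_bounded (M.len W) fun _ => matP_lt_len
instance (W : M.Str) (k a b : M.Num) : Code (matsP W k a b) :=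
  Code.of_bounded (M.len W) fun _ => matsP_lt_len

/-- Equality of sets quantifies over all positions; the common bound `s` turns it into a bounded
quantifier, so that equations between array entries may occur in inductions. -/
theorem DefPred.bitSet_eq {B C : (ℕ → M.Num) → BitSet M} (s : M.Num)
    (hB : ∀ e i, B e i → i < s) (hC : ∀ e i, C e i → i < s)
    [DefPred fun e => B (fun i => e (i + 1)) (e 0)]
    [DefPred fun e => C (fun i => e (i + 1)) (e 0)] : DefPred fun e => B e = C e := by
  refine DefPred.congr (S := fun e => ∀ i, i < s → (B e i ↔ C e i)) inferInstance fun e =>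
    ⟨fun h i _ => by rw [h], fun h => funext fun i => propext ?_⟩
  by_cases hi : i < s
  · exact h i hi
  · exact ⟨fun h => absurd (hB e i h) hi, fun h => absurd (hC e i h) hi⟩

instance (W : M.Str) (f : (ℕ → M.Num) → M.Num) [hf : DefTerm f] (c : BitSet M) [Code c] :
    DefPred fun e => rowP W (f e) = c := by
  have := hf.shift
  obtain ⟨t, ht⟩ := Code.bounded c
  exact DefPred.bitSet_eq (max (M.len W) t) (fun e i h => lt_max_of_lt_left (rowP_lt_len h))
    fun e i h => lt_max_of_lt_right (ht i h)

instance (W : M.Str) (f g : (ℕ → M.Num) → M.Num) [DefTerm f] [DefTerm g] (c : BitSet M)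
    [Code c] : DefPred fun e => matP W (f e) (g e) = c :=
  inferInstanceAs (DefPred fun e => rowP W (pairP (f e) (g e)) = c)

instance (W : M.Str) (k f g : (ℕ → M.Num) → M.Num) [DefTerm k] [DefTerm f] [DefTerm g]
    (c : BitSet M) [Code c] : DefPred fun e => matsP W (k e) (f e) (g e) = c :=
  inferInstanceAs (DefPred fun e => rowP W (pairP (pairP (k e) (f e)) (g e)) = c)

instance (W V : M.Str) (f g : (ℕ → M.Num) → M.Num) [hf : DefTerm f] [hg : DefTerm g] :
    DefPred fun e => rowP W (f e) = rowP V (g e) := by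
  have := hf.shift
  have := hg.shift
  exact DefPred.bitSet_eq (max (M.len W) (M.len V))
    (fun e i h => lt_max_of_lt_left (rowP_lt_len h))
    fun e i h => lt_max_of_lt_right (rowP_lt_len h)

/-! ### Existence of arrays -/

/-- One comprehension on paired positions produces all rows at once; this needs a bound `s` that is
uniform in the rows. -/
theorem exists_rowP (F : M.Num → BitSet M) [DefPred fun e => F (e 1) (e 0)] (q s : M.Num)
    (hs : ∀ l, l < q → ∀ i, F l i → i < s) : ∃ W, ∀ l, l < q → rowP W l = F l := by
  obtain ⟨X, hX⟩ := (Code.of_bounded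
    (b := fun x => ∃ l, l < q ∧ ∃ i, i < s ∧ x = pairP l i ∧ F l i) (pairP q s + 1)
    (by
      rintro _ ⟨l, hl, i, hi, rfl, -⟩
      exact num_lt_succ_iff.2 (pairP_le_pairP hl.le hi.le))).out
  refine ⟨X, fun l hl => funext fun i => propext ((hX _).trans ⟨?_, fun h => ?_⟩)⟩
  · rintro ⟨l', -, i', -, h, h'⟩
    obtain ⟨rfl, rfl⟩ := pairP_inj.1 h
    exact h'
  · exact ⟨l, hl, i, hs l hl i h, rfl, h⟩

theorem exists_matP (F : Matr M) [DefPred fun e => F (e 2) (e 1) (e 0)] (p q s : M.Num)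
    (hs : ∀ a b, a < p → b < q → ∀ i, F a b i → i < s) :
    ∃ W, ∀ a b, a < p → b < q → matP W a b = F a b := by
  obtain ⟨X, hX⟩ := (Code.of_bounded
    (b := fun x => ∃ a, a < p ∧ ∃ b, b < q ∧ ∃ i, i < s ∧ x = pairP (pairP a b) i ∧ F a b i)
    (pairP (pairP p q) s + 1)
    (by
      rintro _ ⟨a, ha, b, hb, i, hi, rfl, -⟩
      exact num_lt_succ_iff.2 (pairP_le_pairP (pairP_le_pairP ha.le hb.le) hi.le))).out
  refine ⟨X, fun a b ha hb => funext fun i => propext ((hX _).trans ⟨?_, fun h => ?_⟩)⟩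
  · rintro ⟨a', -, b', -, i', -, h, h'⟩
    obtain ⟨h₁, rfl⟩ := pairP_inj.1 h
    obtain ⟨rfl, rfl⟩ := pairP_inj.1 h₁
    exact h'
  · exact ⟨a, ha, b, hb, i, hs a b ha hb i h, rfl, h⟩

end Coding

/-! ### Integers: sums with 0, products with 0, 1 and -1 -/

section IntegerArithmetic
variable {M : Model.{u, v}} [hM : IsModel M]

@[simp] theorem eqBitsP_iff {b c : BitSet M} : eqBitsP b c ↔ b = c :=
  ⟨fun h => funext fun i => propext (iffP_iff.1 (h i)), fun h _ => h ▸ iffP_iff.2 Iff.rfl⟩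

@[simp] theorem emptyBitsP_iff {b : BitSet M} : emptyBitsP b ↔ b = zeroB :=
  ⟨fun h => funext fun i => eq_false (h i), fun h _ => h ▸ id⟩

@[simp] theorem isZeroP_iff {b : BitSet M} : isZeroP b ↔ b = zeroB := emptyBitsP_iff

@[simp] theorem isOneP_iff {b : BitSet M} : isOneP b ↔ b = oneB := eqBitsP_iff

@[simp] theorem isNegOneP_iff {b : BitSet M} : isNegOneP b ↔ b = negOneB := eqBitsP_iff

/-! ### Binary addition -/

/-- A carry must start at a common position, so disjoint sets are added by taking their union. -/
theorem natAddP_of_disjoint {b c d : BitSet M} (h : ∀ i, b i → ¬ c i) :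
    natAddP b c d ↔ d = fun i => b i ∨ c i := by
  have hc (i : M.Num) : ¬ carryP b c i := fun ⟨k, _, hb, hc, _⟩ => h k hb hc
  have (i : M.Num) : iffP (d i) (xorP (xorP (b i) (c i)) (carryP b c i)) ↔ (d i ↔ b i ∨ c i) := by
    have := h i
    simp only [iffP_iff, xorP_iff, hc]
    tauto
  exact (forall_congr' this).trans ⟨fun h => funext fun i => propext (h i), fun h i => by rw [h]⟩

theorem natAddP_zero_left {c d : BitSet M} : natAddP zeroB c d ↔ d = c := by
  rw [natAddP_of_disjoint (b := zeroB) fun _ => False.elim]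
  simp only [zeroB, false_or]

theorem natAddP_zero_right {c d : BitSet M} : natAddP c zeroB d ↔ d = c := by
  rw [natAddP_of_disjoint (c := zeroB) fun _ _ => id]
  simp only [zeroB, or_false]

/-- Let k be the greatest position in `b` or `c`. Bit k of the sum is 0, so either both summands
contain k or a carry arrives there; in both cases a carry passes on and sets bit k + 1 of the sum.
-/
theorem eq_zeroB_of_natAddP {b c : BitSet M} [Code b] [Code c] (h : natAddP b c zeroB) :
    b = zeroB := by
  by_contra hb
  obtain ⟨i, hi⟩ : ∃ i, b i := by
    by_contra hi
    exact hb (emptyBitsP_iff.1 fun i h => hi ⟨i, h⟩)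
  obtain ⟨k, hk, hmax⟩ := Code.exists_max (b := fun i => b i ∨ c i) (.inl hi)
  have hlt : k < k + 1 := num_lt_succ_iff.2 le_rfl
  have h0 := h k
  have h1 := h (k + 1)
  simp only [zeroB, iffP_iff, xorP_iff, false_iff, not_not] at h0 h1
  have hb1 : ¬ b (k + 1) := fun h => (hmax _ (.inl h)).not_gt hlt
  have hc1 : ¬ c (k + 1) := fun h => (hmax _ (.inr h)).not_gt hlt
  have hcarry : ¬ carryP b c (k + 1) := h1.not.1 (by simp [hb1, hc1])
  by_cases hbc : b k ∧ c k
  · refine hcarry ⟨k, ltP_iff.2 hlt, hbc.1, hbc.2, fun j => impP_iff.2 fun hj => ?_⟩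
    exact absurd (num_lt_succ_iff.1 (ltP_iff.1 hj.2)) (ltP_iff.1 hj.1).not_ge
  · obtain ⟨k', hk', hb', hc', hj⟩ := h0.1 (by tauto)
    refine hcarry ⟨k', ltP_iff.2 ((ltP_iff.1 hk').trans hlt), hb', hc', fun j =>
      impP_iff.2 fun hj' => ?_⟩
    obtain hjk | rfl := (num_lt_succ_iff.1 (ltP_iff.1 hj'.2)).lt_or_eq
    · exact impP_iff.1 (hj j) ⟨hj'.1, ltP_iff.2 hjk⟩
    · exact hk

/-! ### Binary multiplication -/

def unitB : BitSet M := fun i => i = 0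

/-- An explicit table `F` of partial products gives existence by comprehension. Uniqueness is an
induction that compares any other table row by row with the string that codes `F`. -/
theorem natMulP_iff_of_table {b c r : BitSet M} [Code c] (F : M.Num → BitSet M)
    [DefPred fun e => F (e 1) (e 0)] (h0 : F 0 = zeroB)
    (hmem : ∀ i, c i → ∀ x, natAddP (F i) (shiftP i b) x ↔ x = F (i + 1))
    (hnot : ∀ i, ¬ c i → F (i + 1) = F i)
    (hlast : ∀ l, (∀ i, c i → i < l) → F l = r)
    (hbound : ∃ s, ∀ l i, F l i → i < s) (d : BitSet M) : natMulP b c d ↔ d = r := by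
  obtain ⟨s, hs⟩ := hbound
  constructor
  · rintro ⟨l, hl, W, hW0, hW, hWl⟩
    obtain ⟨V, hV⟩ := exists_rowP F (l + 1) s fun l _ => hs l
    have key : ∀ i, i ≤ l → rowP W i = rowP V i := by
      refine num_induction ?_ ?_
      · intro _
        rw [emptyBitsP_iff.1 hW0, hV 0 (num_lt_succ_iff.2 (num_zero_le l)), h0]
      · intro i ih hi
        have hil : i < l := num_succ_le_iff.1 hi
        have := impP_iff.1 (hW i) (ltP_iff.2 hil)
        rw [impP_iff, impP_iff, ih hil.le, hV i (num_lt_succ_iff.2 hil.le)] at this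
        rw [hV (i + 1) (num_lt_succ_iff.2 hi)]
        by_cases hc : c i
        · exact (hmem i hc _).1 (this.1 hc)
        · rw [hnot i hc]
          exact eqBitsP_iff.1 (this.2 hc)
    rw [← eqBitsP_iff.1 hWl, key l le_rfl, hV l (num_lt_succ_iff.2 le_rfl),
      hlast l fun i hi => ltP_iff.1 (impP_iff.1 (hl i) hi)]
  · rintro rfl
    obtain ⟨l, hl⟩ := Code.bounded c
    obtain ⟨V, hV⟩ := exists_rowP F (l + 1) s fun l _ => hs l
    refine ⟨l, fun i => impP_iff.2 fun hi => ltP_iff.2 (hl i hi), V, ?_, fun i => ?_, ?_⟩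
    · rw [emptyBitsP_iff, hV 0 (num_lt_succ_iff.2 (num_zero_le l)), h0]
    · rw [impP_iff, impP_iff, impP_iff, ltP_iff]
      intro hi
      rw [hV i (num_lt_succ_iff.2 hi.le), hV (i + 1) (num_lt_succ_iff.2 (num_succ_le_iff.2 hi))]
      exact ⟨fun hc => (hmem i hc _).2 rfl, fun hc => eqBitsP_iff.2 (hnot i hc)⟩
    · rw [eqBitsP_iff, hV l (num_lt_succ_iff.2 le_rfl), hlast l hl]

theorem shiftP_zeroB (s : M.Num) : shiftP s zeroB = (zeroB : BitSet M) :=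
  emptyBitsP_iff.1 fun _ ⟨_, _, h⟩ => h

theorem shiftP_unitB (s : M.Num) : shiftP s unitB = (fun i => i = s : BitSet M) :=
  funext fun i => propext ⟨fun ⟨t, h, ht⟩ => by rw [← h, show t = 0 from ht, zero_add],
    fun h => ⟨0, by rw [zero_add, h], rfl⟩⟩

theorem shiftP_zero (b : BitSet M) : shiftP 0 b = b :=
  funext fun i => propext ⟨fun ⟨t, h, ht⟩ => by rwa [← h, add_zero],
    fun h => ⟨i, add_zero i, h⟩⟩

theorem natMulP_zero_left (c d : BitSet M) [Code c] : natMulP zeroB c d ↔ d = zeroB :=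
  natMulP_iff_of_table (fun _ _ => False) rfl
    (fun i _ x => by rw [shiftP_zeroB]; exact natAddP_zero_left)
    (fun _ _ => rfl) (fun _ _ => rfl) ⟨0, fun _ _ => False.elim⟩ d

theorem natMulP_zero_right (b d : BitSet M) : natMulP b zeroB d ↔ d = zeroB :=
  natMulP_iff_of_table (c := zeroB) (fun _ _ => False) rfl (fun _ => False.elim)
    (fun _ _ => rfl) (fun _ _ => rfl) ⟨0, fun _ _ => False.elim⟩ d

theorem natMulP_one_left (c d : BitSet M) [Code c] : natMulP unitB c d ↔ d = c := by
  -- Row l is `c` mod 2^l, and each step adds a single new bit, without carries.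
  refine natMulP_iff_of_table (fun l i => i < l ∧ c i)
    (emptyBitsP_iff.1 fun i h => (num_zero_le i).not_gt h.1) (fun i hi x => ?_) (fun i hi => ?_)
    (fun l hl => funext fun i => propext ⟨And.right, fun h => ⟨hl i h, h⟩⟩)
    (let ⟨s, hs⟩ := Code.bounded c; ⟨s, fun l i h => hs i h.2⟩) d
  · rw [shiftP_unitB, natAddP_of_disjoint fun j hj => hj.1.ne]
    have : (fun j => j < i ∧ c j ∨ j = i) = fun j => j < i + 1 ∧ c j := funext fun j => propext <| by
      rw [num_lt_succ_iff, le_iff_lt_or_eq]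
      refine ⟨?_, by tauto⟩
      rintro (h | rfl)
      · exact ⟨.inl h.1, h.2⟩
      · exact ⟨.inr rfl, hi⟩
    rw [this]
  · refine funext fun j => propext ?_
    rw [num_lt_succ_iff, le_iff_lt_or_eq]
    refine ⟨?_, fun h => ⟨.inl h.1, h.2⟩⟩
    rintro ⟨h | rfl, h'⟩
    · exact ⟨h, h'⟩
    · exact absurd h' hi

instance : Code (unitB (M := M)) :=
  Code.of_bounded (b := fun i => i = 0) 1 fun i hi => by rw [hi]; exact zero_lt_one

theorem natMulP_one_right (b d : BitSet M) [Code b] : natMulP b unitB d ↔ d = b := by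
  -- The only position in the multiplier is 0, so the table is 0 at l = 0 and `b` from then on.
  refine natMulP_iff_of_table (c := unitB) (fun l i => 0 < l ∧ b i)
    (emptyBitsP_iff.1 fun i h => lt_irrefl _ h.1) (fun i hi x => ?_) (fun i hi => ?_)
    (fun l hl => funext fun i => propext ⟨And.right, fun h => ⟨hl 0 rfl, h⟩⟩)
    (let ⟨s, hs⟩ := Code.bounded b; ⟨s, fun l i h => hs i h.2⟩) d
  · have h0 : (fun j => (0 : M.Num) < 0 ∧ b j) = zeroB :=
      emptyBitsP_iff.1 fun i h => lt_irrefl _ h.1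
    have h1 : (fun j => (0 : M.Num) < 0 + 1 ∧ b j) = b :=
      funext fun i => propext ⟨And.right, fun h => ⟨num_lt_succ_iff.2 le_rfl, h⟩⟩
    rw [show i = 0 from hi, shiftP_zero, h0, h1]
    exact natAddP_zero_left
  · refine funext fun j => propext (and_congr_left fun _ => ?_)
    exact iff_of_true (num_lt_succ_iff.2 (num_zero_le i)) ((num_zero_le i).lt_of_ne' hi)

/-! ### Integers -/

@[simp] theorem magP_zeroB : magP zeroB = (zeroB : BitSet M) := rfl

@[simp] theorem magP_oneB : magP oneB = (unitB : BitSet M) := funext fun i => propext <| by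
  simp [magP, oneB, unitB]

@[simp] theorem magP_negOneB : magP negOneB = (unitB : BitSet M) := funext fun i => propext <| by
  simp [magP, negOneB, unitB]

instance (b : BitSet M) [Code b] : Code (magP b) := by
  obtain ⟨s, hs⟩ := Code.bounded b
  exact Code.of_bounded (b := fun i => b (i + 1)) s fun i hi =>
    (num_succ_le_iff.1 (le_refl (i + 1))).trans (hs _ hi)

theorem isIntP_iff {b : BitSet M} : isIntP b ↔ (b 0 → nonzeroP b) := impP_iff

theorem nonzeroP_iff {b : BitSet M} : nonzeroP b ↔ magP b ≠ zeroB := by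
  rw [Ne, ← emptyBitsP_iff, emptyBitsP, not_forall]
  simp only [not_not, nonzeroP]

theorem bitSet_ext {b c : BitSet M} (h : b 0 ↔ c 0) (h' : magP b = magP c) : b = c := by
  refine funext fun i => propext ?_
  obtain rfl | ⟨i, rfl⟩ := num_eq_zero_or_succ i
  · exact h
  · exact iff_of_eq (congrFun h' i)

theorem int_ext {b c : BitSet M} (hb : isIntP b) (hc : isIntP c) (h : nonzeroP b → (b 0 ↔ c 0))
    (h' : magP b = magP c) : b = c := by
  refine bitSet_ext ?_ h'
  by_cases hn : nonzeroP b
  · exact h hn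
  · have hn' : ¬ nonzeroP c := by rwa [nonzeroP_iff, ← h', ← nonzeroP_iff]
    exact iff_of_false (fun h => hn (isIntP_iff.1 hb h)) (fun h => hn' (isIntP_iff.1 hc h))

/-- The negative of an integer. -/
def negB (b : BitSet M) : BitSet M := fun i => (i = 0 ∧ ¬ b 0 ∧ nonzeroP b) ∨ (i ≠ 0 ∧ b i)

instance (b : BitSet M) [Code b] : Code (negB b) := by
  obtain ⟨s, hs⟩ := Code.bounded b
  exact Code.of_bounded (b := fun i => (i = 0 ∧ ¬ b 0 ∧ nonzeroP b) ∨ (i ≠ 0 ∧ b i)) (s + 1)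
    fun i hi => num_lt_succ_iff.2 <| hi.elim (fun h => h.1 ▸ num_zero_le s) fun h => (hs i h.2).le

@[simp] theorem magP_negB (b : BitSet M) : magP (negB b) = magP b := funext fun i => propext <| by
  simp [magP, negB]

theorem negB_zero_iff {b : BitSet M} : negB b 0 ↔ ¬ b 0 ∧ nonzeroP b := by simp [negB]

theorem isIntP_negB (b : BitSet M) : isIntP (negB b) := isIntP_iff.2 fun h => by
  rw [nonzeroP_iff, magP_negB, ← nonzeroP_iff]
  exact (negB_zero_iff.1 h).2

theorem isIntP_zeroB : isIntP (zeroB : BitSet M) := isIntP_iff.2 False.elim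

theorem isIntP_oneB : isIntP (oneB : BitSet M) := isIntP_iff.2 fun _ => ⟨0, zero_add 1⟩

theorem isIntP_negOneB : isIntP (negOneB : BitSet M) := isIntP_iff.2 fun _ =>
  ⟨0, .inr (zero_add 1)⟩

theorem not_oneB_zero : ¬ (oneB : BitSet M) 0 := zero_ne_one (α := M.Num)

theorem negOneB_zero : (negOneB : BitSet M) 0 := .inl rfl

@[simp] theorem negB_zeroB : negB zeroB = (zeroB : BitSet M) :=
  bitSet_ext (negB_zero_iff.trans (by simp [nonzeroP_iff, zeroB])) (by simp)

@[simp] theorem negB_oneB : negB oneB = (negOneB : BitSet M) :=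
  bitSet_ext (negB_zero_iff.trans (iff_of_true ⟨not_oneB_zero, 0, zero_add 1⟩ negOneB_zero))
    (by simp)

@[simp] theorem negB_negOneB : negB negOneB = (oneB : BitSet M) :=
  bitSet_ext (negB_zero_iff.trans (iff_of_false (fun h => h.1 negOneB_zero) not_oneB_zero))
    (by simp)

theorem intAddP_zero_left {c d : BitSet M} [Code c] [Code d] (hc : isIntP c) :
    intAddP zeroB c d ↔ d = c := by
  simp only [intAddP, iffP_iff, xorP_iff, signP, magP_zeroB, natAddP_zero_left]
  have hz : ¬ zeroB (0 : M.Num) := id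
  constructor
  · rintro ⟨hd, ⟨h1, h2, h3⟩ | ⟨h1, ⟨h2, h3⟩ | ⟨h2, h3⟩⟩⟩
    · exact bitSet_ext (h2.trans h1) h3
    · have hc0 : c 0 := by tauto
      -- Here |c| + |d| = 0 although c is negative.
      exact absurd (eq_zeroB_of_natAddP h3) (nonzeroP_iff.1 (isIntP_iff.1 hc hc0))
    · exact bitSet_ext h2 h3.symm
  · rintro rfl
    refine ⟨hc, ?_⟩
    by_cases h0 : d 0
    · exact .inr ⟨by tauto, .inr ⟨Iff.rfl, rfl⟩⟩
    · exact .inl ⟨by tauto, by tauto, rfl⟩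

theorem intAddP_zero_right {c d : BitSet M} [Code c] [Code d] (hc : isIntP c) :
    intAddP c zeroB d ↔ d = c := by
  simp only [intAddP, iffP_iff, xorP_iff, signP, magP_zeroB, natAddP_zero_left, natAddP_zero_right]
  have hz : ¬ zeroB (0 : M.Num) := id
  constructor
  · rintro ⟨hd, ⟨h1, h2, h3⟩ | ⟨h1, ⟨h2, h3⟩ | ⟨h2, h3⟩⟩⟩
    · exact bitSet_ext h2 h3
    · exact bitSet_ext h2 h3.symm
    · have hc0 : c 0 := by tauto
      exact absurd (eq_zeroB_of_natAddP h3) (nonzeroP_iff.1 (isIntP_iff.1 hc hc0))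
  · rintro rfl
    refine ⟨hc, ?_⟩
    by_cases h0 : d 0
    · exact .inr ⟨by tauto, .inl ⟨Iff.rfl, rfl⟩⟩
    · exact .inl ⟨by tauto, by tauto, rfl⟩

/-- Since zero carries no sign, the magnitude and the sign of a nonzero value determine the code;
only these two have to be checked for each special product. -/
theorem intMulP_iff {b c d r : BitSet M} (hr : isIntP r)
    (hmag : natMulP (magP b) (magP c) (magP d) ↔ magP d = magP r)
    (hsign : nonzeroP r → (r 0 ↔ ¬ (b 0 ↔ c 0))) : intMulP b c d ↔ d = r := by
  simp only [intMulP, iffP_iff, xorP_iff, impP_iff, signP, hmag]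
  constructor
  · rintro ⟨hd, h, h'⟩
    have hn : nonzeroP d ↔ nonzeroP r := by rw [nonzeroP_iff, h, nonzeroP_iff]
    exact int_ext hd hr (fun hnd => (h' hnd).trans (hsign (hn.1 hnd)).symm) h
  · rintro rfl
    exact ⟨hr, rfl, hsign⟩

theorem not_nonzeroP_zeroB : ¬ nonzeroP (zeroB : BitSet M) := fun ⟨_, h⟩ => h

theorem intMulP_zero_left (c d : BitSet M) [Code c] : intMulP zeroB c d ↔ d = zeroB :=
  intMulP_iff isIntP_zeroB (natMulP_zero_left _ _) fun h => absurd h not_nonzeroP_zeroB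

theorem intMulP_zero_right (b d : BitSet M) : intMulP b zeroB d ↔ d = zeroB :=
  intMulP_iff isIntP_zeroB (natMulP_zero_right _ _) fun h => absurd h not_nonzeroP_zeroB

theorem intMulP_one_left {c d : BitSet M} [Code c] (hc : isIntP c) : intMulP oneB c d ↔ d = c :=
  intMulP_iff hc (by rw [magP_oneB]; exact natMulP_one_left _ _) fun _ => by
    have := not_oneB_zero (M := M); tauto

theorem intMulP_one_right {c d : BitSet M} [Code c] (hc : isIntP c) : intMulP c oneB d ↔ d = c :=
  intMulP_iff hc (by rw [magP_oneB]; exact natMulP_one_right _ _) fun _ => by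
    have := not_oneB_zero (M := M); tauto

theorem intMulP_negOne_left {c d : BitSet M} [Code c] : intMulP negOneB c d ↔ d = negB c :=
  intMulP_iff (isIntP_negB c) (by rw [magP_negOneB, magP_negB]; exact natMulP_one_left _ _)
    fun h => by
      rw [nonzeroP_iff, magP_negB, ← nonzeroP_iff] at h
      rw [negB_zero_iff]
      have := negOneB_zero (M := M); tauto

theorem intMulP_negOne_right {c d : BitSet M} [Code c] : intMulP c negOneB d ↔ d = negB c :=
  intMulP_iff (isIntP_negB c) (by rw [magP_negOneB, magP_negB]; exact natMulP_one_right _ _)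
    fun h => by
      rw [nonzeroP_iff, magP_negB, ← nonzeroP_iff] at h
      rw [negB_zero_iff]
      have := negOneB_zero (M := M); tauto

end IntegerArithmetic

section Dot
variable {M : Model.{u, v}} [hM : IsModel M]

/-! ### Inner products -/

/-- The integer `w` is the product of `b` and `c`, and the only one. -/
def IsProd (b c w : BitSet M) : Prop := ∀ d, intMulP b c d ↔ d = w

/-- `∑ l < q, x l * y l = d`. -/
def DotV (q : M.Num) (x y : M.Num → BitSet M) (d : BitSet M) : Prop :=
  ∃ T : M.Str, rowP T 0 = zeroB ∧
    (∀ l, l < q → ∃ V : M.Str, intMulP (x l) (y l) (fun i => M.mem i V) ∧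
      intAddP (rowP T l) (fun i => M.mem i V) (rowP T (l + 1))) ∧
    rowP T q = d

theorem dotP_iff {q : M.Num} {A B : Matr M} {a b : M.Num} {d : BitSet M} :
    dotP q A B a b d ↔ DotV q (fun l => A a l) (fun l => B l b) d := by
  simp only [dotP, DotV, isZeroP_iff, impP_iff, ltP_iff, eqBitsP_iff]

theorem matMulP_iff {p q r : M.Num} {A B C : Matr M} : matMulP p q r A B C ↔
    ∀ a b, a < p → b < r → DotV q (fun l => A a l) (fun l => B l b) (C a b) := by
  simp only [matMulP, impP_iff, ltP_iff, and_imp, dotP_iff]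

theorem DotV.isIntP {q : M.Num} {x y : M.Num → BitSet M} {d : BitSet M} (h : DotV q x y d) :
    isIntP d := by
  obtain ⟨T, hT0, hT, rfl⟩ := h
  obtain rfl | ⟨q, rfl⟩ := num_eq_zero_or_succ q
  · rw [hT0]; exact isIntP_zeroB
  · obtain ⟨V, -, hV⟩ := hT q (num_lt_succ_iff.2 le_rfl)
    exact hV.1

theorem DotV.congr {q : M.Num} {x y x' y' : M.Num → BitSet M} {d : BitSet M} (h : DotV q x y d)
    (hx : ∀ l, l < q → x' l = x l) (hy : ∀ l, l < q → y' l = y l) : DotV q x' y' d := by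
  obtain ⟨T, hT0, hT, rfl⟩ := h
  exact ⟨T, hT0, fun l hl => by rw [hx l hl, hy l hl]; exact hT l hl, rfl⟩

theorem dotV_congr {q : M.Num} {x y x' y' : M.Num → BitSet M} {d : BitSet M}
    (hx : ∀ l, l < q → x l = x' l) (hy : ∀ l, l < q → y l = y' l) :
    DotV q x y d ↔ DotV q x' y' d :=
  ⟨fun h => h.congr (fun l hl => (hx l hl).symm) fun l hl => (hy l hl).symm,
    fun h => h.congr hx hy⟩

/-- A definable, uniformly bounded family of partial sums is enough for the inner product to exist.
-/
theorem dotV_of_table {q : M.Num} {x y : M.Num → BitSet M} (F : M.Num → BitSet M)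
    [DefPred fun e => F (e 1) (e 0)] (hF : ∃ s, ∀ l i, F l i → i < s) (h0 : F 0 = zeroB)
    (h : ∀ l, l < q → ∃ w, Code w ∧ IsProd (x l) (y l) w ∧ intAddP (F l) w (F (l + 1))) :
    DotV q x y (F q) := by
  obtain ⟨s, hs⟩ := hF
  obtain ⟨T, hT⟩ := exists_rowP F (q + 1) s fun l _ => hs l
  refine ⟨T, ?_, fun l hl => ?_, hT q (num_lt_succ_iff.2 le_rfl)⟩
  · rw [hT 0 (num_lt_succ_iff.2 (num_zero_le q)), h0]
  · obtain ⟨w, hw, hp, ha⟩ := h l hl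
    obtain ⟨V, rfl⟩ := Code.exists_eq w
    refine ⟨V, (hp _).2 rfl, ?_⟩
    rwa [hT l (num_lt_succ_iff.2 hl.le), hT (l + 1) (num_lt_succ_iff.2 (num_succ_le_iff.2 hl))]

/-- Partial sums do not change along a stretch of zero terms. -/
theorem rowP_eq_of_isProd_zeroB {q : M.Num} {x y : M.Num → BitSet M} {T : M.Str}
    (hT : ∀ l, l < q → ∃ V : M.Str, intMulP (x l) (y l) (fun i => M.mem i V) ∧
      intAddP (rowP T l) (fun i => M.mem i V) (rowP T (l + 1))) {a : M.Num}
    (ha : isIntP (rowP T a)) : ∀ b, a ≤ b → b ≤ q →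
      (∀ l, a ≤ l → l < b → IsProd (x l) (y l) zeroB) → rowP T b = rowP T a := by
  intro b hab hbq h
  refine num_induction (S := fun c => a ≤ c → c ≤ b → rowP T c = rowP T a) ?_ ?_ b hab le_rfl
  · intro h0 _
    rw [le_antisymm h0 (num_zero_le a)]
  · intro c ih hac hcb
    obtain rfl | hac := hac.eq_or_lt
    · rfl
    have hac := num_lt_succ_iff.1 hac
    have hcb := num_succ_le_iff.1 hcb
    obtain ⟨V, hV, hV'⟩ := hT c (hcb.trans_le hbq)
    rw [(h c hac hcb _).1 hV, ih hac hcb.le, intAddP_zero_right ha] at hV'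
    exact hV'

theorem dotV_zero_iff {q : M.Num} {x y : M.Num → BitSet M}
    (h : ∀ l, l < q → IsProd (x l) (y l) zeroB) (d : BitSet M) : DotV q x y d ↔ d = zeroB := by
  constructor
  · rintro ⟨T, hT0, hT, rfl⟩
    rw [rowP_eq_of_isProd_zeroB hT (a := 0) (hT0 ▸ isIntP_zeroB) q (num_zero_le q) le_rfl
      fun l _ => h l, hT0]
  · rintro rfl
    exact dotV_of_table (fun _ _ => False) ⟨0, fun _ _ => False.elim⟩ rfl fun l hl =>
      ⟨zeroB, inferInstance, h l hl, (intAddP_zero_left (c := zeroB) (d := zeroB) isIntP_zeroB).2 rfl⟩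

theorem dotV_single_iff {q : M.Num} {x y : M.Num → BitSet M} {a : M.Num} (ha : a < q)
    (h : ∀ l, l < q → l ≠ a → IsProd (x l) (y l) zeroB) {w : BitSet M} [Code w] (hw : isIntP w)
    (hp : IsProd (x a) (y a) w) (d : BitSet M) : DotV q x y d ↔ d = w := by
  constructor
  · rintro ⟨T, hT0, hT, rfl⟩
    have h1 : rowP T a = zeroB := by
      rw [rowP_eq_of_isProd_zeroB hT (a := 0) (hT0 ▸ isIntP_zeroB) a (num_zero_le a) ha.le
        fun l _ hl => h l (hl.trans ha) hl.ne, hT0]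
    have h2 : rowP T (a + 1) = w := by
      obtain ⟨V, hV, hV'⟩ := hT a ha
      rwa [h1, (hp _).1 hV, intAddP_zero_left hw] at hV'
    rw [rowP_eq_of_isProd_zeroB hT (a := a + 1) (h2 ▸ hw) q (num_succ_le_iff.2 ha) le_rfl
      fun l hl hlq => h l hlq (num_succ_le_iff.1 hl).ne', h2]
  · rintro rfl
    have hlt (l : M.Num) (hl : l ≤ a) : (fun i => a < l ∧ d i) = zeroB :=
      emptyBitsP_iff.1 fun i hi => hl.not_gt hi.1
    have hgt (l : M.Num) (hl : a < l) : (fun i => a < l ∧ d i) = d :=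
      funext fun i => propext (and_iff_right hl)
    have := dotV_of_table (x := x) (y := y) (q := q) (fun l i => a < l ∧ d i)
      (let ⟨s, hs⟩ := Code.bounded d; ⟨s, fun l i hi => hs i hi.2⟩)
      (hlt 0 (num_zero_le a)) fun l hl => by
        rcases lt_trichotomy l a with hla | rfl | hla
        · refine ⟨zeroB, inferInstance, h l hl hla.ne, ?_⟩
          rw [hlt l hla.le, hlt _ (num_succ_le_iff.2 hla), intAddP_zero_left isIntP_zeroB]
        · refine ⟨d, inferInstance, hp, ?_⟩
          rw [hlt l le_rfl, hgt _ (num_lt_succ_iff.2 le_rfl), intAddP_zero_left hw]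
        · refine ⟨zeroB, inferInstance, h l hl hla.ne', ?_⟩
          rw [hgt l hla, hgt _ (num_lt_succ_iff.2 hla.le), intAddP_zero_right hw]
    rwa [hgt q ha] at this

/-- The sum stays the relation `intAddP w z d` and is never evaluated. The term with the smaller
index is always the first summand, so two such sums can be compared without commutativity of
addition. -/
theorem dotV_double_iff {q : M.Num} {x y : M.Num → BitSet M} {a b : M.Num} (hab : a < b)
    (hb : b < q) (h : ∀ l, l < q → l ≠ a → l ≠ b → IsProd (x l) (y l) zeroB) {w z : BitSet M}
    [Code w] [Code z] (hw : isIntP w) (hpw : IsProd (x a) (y a) w) (hpz : IsProd (x b) (y b) z)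
    (d : BitSet M) [Code d] : DotV q x y d ↔ intAddP w z d := by
  have ha := hab.trans hb
  constructor
  · rintro ⟨T, hT0, hT, rfl⟩
    -- The same table, cut off at `b`, has only one nonzero term.
    have h1 : rowP T b = w := (dotV_single_iff hab (fun l hl hla => h l (hl.trans hb) hla hl.ne) hw
      hpw _).1 ⟨T, hT0, fun l hl => hT l (hl.trans hb), rfl⟩
    obtain ⟨V, hV, hV'⟩ := hT b hb
    rw [h1, (hpz _).1 hV] at hV'
    rwa [rowP_eq_of_isProd_zeroB hT (a := b + 1) hV'.1 q (num_succ_le_iff.2 hb) le_rfl fun l hl hlq =>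
      h l hlq (hab.trans (num_succ_le_iff.1 hl)).ne' (num_succ_le_iff.1 hl).ne']
  · intro hd
    -- The partial sums are 0 up to `a`, then `w` up to `b`, then `d`.
    let F : M.Num → BitSet M := fun l i => (a < l ∧ l ≤ b ∧ w i) ∨ (b < l ∧ d i)
    have h0 (l : M.Num) (hl : l ≤ a) : F l = zeroB := emptyBitsP_iff.1 fun i hi =>
      hi.elim (fun h => hl.not_gt h.1) fun h => hl.not_gt (hab.trans h.1)
    have h1 (l : M.Num) (hl : a < l) (hl' : l ≤ b) : F l = w := funext fun i => propext <| by
      simp [F, hl, hl', hl'.not_gt]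
    have h2 (l : M.Num) (hl : b < l) : F l = d := funext fun i => propext <| by
      simp [F, hl, hl.not_ge]
    have := dotV_of_table (x := x) (y := y) (q := q) F
      (by
        obtain ⟨s, hs⟩ := Code.bounded d
        obtain ⟨t, ht⟩ := Code.bounded w
        exact ⟨max s t, fun l i hi => hi.elim (fun h => lt_max_of_lt_right (ht i h.2.2)) fun h =>
          lt_max_of_lt_left (hs i h.2)⟩)
      (h0 0 (num_zero_le a)) fun l hl => by
        rcases lt_trichotomy l a with hla | rfl | hla
        · refine ⟨zeroB, inferInstance, h l hl hla.ne (hla.trans hab).ne, ?_⟩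
          rw [h0 l hla.le, h0 _ (num_succ_le_iff.2 hla), intAddP_zero_left isIntP_zeroB]
        · refine ⟨w, inferInstance, hpw, ?_⟩
          rw [h0 l le_rfl, h1 _ (num_lt_succ_iff.2 le_rfl) (num_succ_le_iff.2 hab),
            intAddP_zero_left hw]
        rcases lt_trichotomy l b with hlb | rfl | hlb
        · refine ⟨zeroB, inferInstance, h l hl hla.ne' hlb.ne, ?_⟩
          rw [h1 l hla hlb.le, h1 _ (num_lt_succ_iff.2 hla.le) (num_succ_le_iff.2 hlb),
            intAddP_zero_right hw]
        · refine ⟨z, inferInstance, hpz, ?_⟩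
          rwa [h1 l hla le_rfl, h2 _ (num_lt_succ_iff.2 le_rfl)]
        · refine ⟨zeroB, inferInstance, h l hl hla.ne' hlb.ne', ?_⟩
          rw [h2 l hlb, h2 _ (num_lt_succ_iff.2 hlb.le), intAddP_zero_right hd.1]
    rwa [h2 q hb] at this

/-! ### The integers `0`, `1` and `-1` -/

/-- `-1` if `q` holds, otherwise `1` if `p` holds, otherwise `0`. -/
def sgnB (p q : Prop) : BitSet M := fun i => (p ∧ i = 1) ∨ (q ∧ (i = 0 ∨ i = 1))

theorem sgnB_eq_negOneB {p q : Prop} (hq : q) : sgnB p q = (negOneB : BitSet M) :=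
  funext fun i => propext <| by simp only [sgnB, negOneB, hq]; tauto

theorem sgnB_eq_oneB {p q : Prop} (hp : p) (hq : ¬ q) : sgnB p q = (oneB : BitSet M) :=
  funext fun i => propext <| by simp [sgnB, oneB, hq, hp]

theorem sgnB_eq_zeroB {p q : Prop} (hp : ¬ p) (hq : ¬ q) : sgnB p q = (zeroB : BitSet M) :=
  emptyBitsP_iff.1 fun i => by simp [sgnB, hq, hp]

theorem sgnB_cases (p q : Prop) :
    sgnB p q = (zeroB : BitSet M) ∨ sgnB p q = (oneB : BitSet M) ∨
      sgnB p q = (negOneB : BitSet M) := by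
  by_cases hq : q
  · exact .inr (.inr (sgnB_eq_negOneB hq))
  · by_cases hp : p
    · exact .inr (.inl (sgnB_eq_oneB hp hq))
    · exact .inl (sgnB_eq_zeroB hp hq)

theorem sgnB_lt (p q : Prop) (i : M.Num) (h : sgnB p q i) : i < 1 + 1 := num_lt_succ_iff.2 <|
  h.elim (fun h => h.2.le) fun h => h.2.elim (fun h => h ▸ num_zero_le 1) fun h => h.le

instance (p q : Prop) : Code (sgnB p q : BitSet M) :=
  Code.of_bounded (b := fun i => (p ∧ i = 1) ∨ (q ∧ (i = 0 ∨ i = 1))) (1 + 1) (sgnB_lt p q)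

theorem isIntP_sgnB (p q : Prop) : isIntP (sgnB p q : BitSet M) := by
  rcases sgnB_cases (M := M) p q with h | h | h <;> rw [h]
  exacts [isIntP_zeroB, isIntP_oneB, isIntP_negOneB]

theorem isProd_zero_left (c : BitSet M) [Code c] : IsProd zeroB c zeroB :=
  fun d => intMulP_zero_left c d

theorem isProd_zero_right (c : BitSet M) : IsProd c zeroB zeroB :=
  fun d => intMulP_zero_right c d

theorem isProd_one_left {c : BitSet M} [Code c] (hc : isIntP c) : IsProd oneB c c :=
  fun _ => intMulP_one_left hc

theorem isProd_one_right {c : BitSet M} [Code c] (hc : isIntP c) : IsProd c oneB c :=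
  fun _ => intMulP_one_right hc

theorem isProd_negOne_left (c : BitSet M) [Code c] : IsProd negOneB c (negB c) :=
  fun _ => intMulP_negOne_left

theorem isProd_negOne_right (c : BitSet M) [Code c] : IsProd c negOneB (negB c) :=
  fun _ => intMulP_negOne_right

/-! ### Parity -/

theorem num_lt_iff_exists_add {x y : M.Num} : x < y ↔ ∃ z, y = x + z + 1 := by
  rw [← num_succ_le_iff, num_le_iff_exists_add]
  exact exists_congr fun z => by rw [add_right_comm]

theorem num_ne_add_succ_add (x y : M.Num) : x ≠ x + y + 1 := by
  rw [add_assoc]; exact num_ne_add_succ x y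

/-- Whichever of s and t is larger, writing it as the other plus a difference makes some number
equal to itself plus a successor. -/
theorem double_ne_double_succ (s t : M.Num) : s + s ≠ t + t + 1 := fun h => by
  rcases lt_or_ge t s with hts | hts
  · obtain ⟨z, rfl⟩ := num_lt_iff_exists_add.1 hts
    refine num_ne_add_succ_add (t + t + 1) (z + z) (h.symm.trans ?_)
    ring
  · obtain ⟨z, rfl⟩ := num_le_iff_exists_add.1 hts
    refine num_ne_add_succ_add (s + s) (z + z) (h.trans ?_)
    ring

theorem double_inj {s t : M.Num} : s + s = t + t ↔ s = t := by
  refine ⟨fun h => ?_, fun h => by rw [h]⟩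
  rcases lt_trichotomy s t with hst | hst | hst
  · exact absurd h (add_lt_add hst hst).ne
  · exact hst
  · exact absurd h (add_lt_add hst hst).ne'

theorem num_even_or_odd (x : M.Num) : (∃ t, x = t + t) ∨ ∃ t, x = t + t + 1 := by
  have : (∃ t, t ≤ x ∧ x = t + t) ∨ ∃ t, t ≤ x ∧ x = t + t + 1 := by
    refine num_induction (S := fun x => (∃ t, t ≤ x ∧ x = t + t) ∨ ∃ t, t ≤ x ∧ x = t + t + 1)
      (.inl ⟨0, le_rfl, (add_zero 0).symm⟩) ?_ x
    rintro x (⟨t, ht, rfl⟩ | ⟨t, ht, rfl⟩)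
    · exact .inr ⟨t, ht.trans (num_lt_succ_iff.2 le_rfl).le, rfl⟩
    · refine .inl ⟨t + 1, ?_, by ring⟩
      gcongr
  exact this.imp (fun ⟨t, _, h⟩ => ⟨t, h⟩) fun ⟨t, _, h⟩ => ⟨t, h⟩

theorem upperP_even {t b : M.Num} : upperP (t + t) b ↔ b = t + t + 1 :=
  ⟨fun ⟨s, h, h'⟩ => by rw [double_inj.1 h, h'], fun h => ⟨t, rfl, h⟩⟩

theorem not_upperP_odd {t b : M.Num} : ¬ upperP (t + t + 1) b :=
  fun ⟨_, h, _⟩ => double_ne_double_succ _ _ h.symm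

theorem upperP_odd_right {t a : M.Num} : upperP a (t + t + 1) ↔ a = t + t :=
  ⟨fun ⟨s, h, h'⟩ => by rw [h, double_inj.1 (add_right_cancel h')], fun h => ⟨t, h, rfl⟩⟩

theorem not_upperP_even_right {t a : M.Num} : ¬ upperP a (t + t) :=
  fun ⟨_, _, h⟩ => double_ne_double_succ _ _ h

instance (f g : (ℕ → M.Num) → M.Num) [hf : DefTerm f] [hg : DefTerm g] :
    DefPred fun e => upperP (f e) (g e) := by
  have := hf.shift
  have := hg.shift
  refine DefPred.congr (S := fun e => ∃ t, t ≤ f e ∧ f e = t + t ∧ g e = t + t + 1)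
    inferInstance fun e => exists_congr fun t => ⟨fun h => ⟨?_, h⟩, And.right⟩
  rw [h.1]
  exact num_le_iff_exists_add.2 ⟨t, rfl⟩

end Dot

/-! ### Matrices with entries 0, 1, -1 and the coefficients of the PB matrix -/

section Matrices
variable {M : Model.{u, v}} [hM : IsModel M]

theorem eq_sgnB_iff {p q : Prop} (h : p → ¬ q) (x : BitSet M) :
    (impP p (isOneP x) ∧ impP q (isNegOneP x) ∧ impP (¬ p ∧ ¬ q) (isZeroP x)) ↔
      x = sgnB p q := by
  simp only [impP_iff, isOneP_iff, isNegOneP_iff, isZeroP_iff]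
  by_cases hq : q
  · simp [hq, sgnB_eq_negOneB, show ¬ p from fun hp => h hp hq]
  by_cases hp : p
  · simp [hp, hq, sgnB_eq_oneB]
  · simp [hp, hq, sgnB_eq_zeroB]

theorem isBlockIdentityP_iff {N : M.Num} {A : Matr M} : isBlockIdentityP N A ↔
    ∀ a b, a < N + N → b < N + N → A a b = sgnB (b = a + N) (a = b + N) := by
  simp only [isBlockIdentityP, impP_iff (b := _ ∧ _), ltP_iff, and_imp]
  refine forall₄_congr fun a b ha hb => eq_sgnB_iff (fun h h' => ?_) _
  subst h
  rw [add_assoc] at h'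
  obtain h0 | ⟨x, hx⟩ := num_eq_zero_or_succ (N + N)
  · exact (num_zero_le a).not_gt (h0 ▸ ha)
  · exact num_ne_add_succ a x (hx ▸ h')

theorem isJP_iff {m : M.Num} {A : Matr M} : isJP m A ↔
    ∀ a b, a < m → b < m → A a b = sgnB (upperP a b) (upperP b a) := by
  simp only [isJP, impP_iff (b := _ ∧ _), ltP_iff, and_imp]
  refine forall₄_congr fun a b ha hb => eq_sgnB_iff (fun ⟨t, _, h⟩ h' => ?_) _
  subst h
  exact not_upperP_odd h'

theorem isIdP_iff {m : M.Num} {A : Matr M} : isIdP m A ↔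
    ∀ a b, a < m → b < m → A a b = sgnB (a = b) False := by
  simp only [isIdP, impP_iff, ltP_iff, and_imp, isOneP_iff, isZeroP_iff]
  refine forall₄_congr fun a b ha hb => ?_
  by_cases h : a = b
  · simp [h, sgnB_eq_oneB]
  · simp [h, sgnB_eq_zeroB]

theorem eqMatP_iff {p q : M.Num} {A B : Matr M} : eqMatP p q A B ↔
    ∀ a b, a < p → b < q → A a b = B a b := by
  simp only [eqMatP, impP_iff, ltP_iff, and_imp, eqBitsP_iff]

/-- This is where the matrix powering axiom enters. -/
theorem exists_matPowP {m : M.Num} {X : M.Str} (h : ∀ a b, a < m → b < m → isIntP (matP X a b))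
    (n : M.Num) : ∃ Y, matPowP m (matP X) n (matP Y) := by
  have := hM.models matrixPowering (.inr (.inr rfl)) (fun _ => 0) fun _ => X
  rw [sat_matrixPowering] at this
  refine impP_iff.1 (this m n X) fun a b => ?_
  rw [impP_iff, ltP_iff, ltP_iff]
  exact fun hab => h a b hab.1 hab.2

theorem isIntP_of_powers {m n : M.Num} {A : Matr M} {P : M.Str} (h0 : isIdP m (matsP P 0))
    (h : ∀ k, k < n → matMulP m m m (matsP P k) A (matsP P (k + 1))) {k a b : M.Num} (hk : k ≤ n)
    (ha : a < m) (hb : b < m) : isIntP (matsP P k a b) := by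
  obtain rfl | ⟨k, rfl⟩ := num_eq_zero_or_succ k
  · rw [isIdP_iff.1 h0 a b ha hb]
    exact isIntP_sgnB _ _
  · exact (matMulP_iff.1 (h k (num_succ_le_iff.1 hk)) a b ha hb).isIntP

theorem exists_isJP (m : M.Num) : ∃ J, isJP m (matP J) := by
  obtain ⟨J, hJ⟩ := exists_matP (fun a b i => (upperP a b ∧ i = 1) ∨
    (upperP b a ∧ (i = 0 ∨ i = 1))) m m (1 + 1) fun a b _ _ => sgnB_lt _ _
  exact ⟨J, isJP_iff.2 hJ⟩

instance (W : M.Str) (f g h : (ℕ → M.Num) → M.Num) [hf : DefTerm f] [hg : DefTerm g]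
    [hh : DefTerm h] : DefPred fun e => negB (matP W (f e) (g e)) (h e) := by
  have := hf.shift
  have := hg.shift
  refine DefPred.congr (S := fun e => (h e = 0 ∧ ¬ matP W (f e) (g e) 0 ∧
    ∃ i, i < M.len W ∧ matP W (f e) (g e) (i + 1)) ∨ (h e ≠ 0 ∧ matP W (f e) (g e) (h e)))
    (inferInstanceAs (DefPred fun e => (h e = 0 ∧ ¬ matP W (f e) (g e) 0 ∧
      ∃ i, i < M.len W ∧ matP W (f e) (g e) (i + 1)) ∨
      (¬ h e = 0 ∧ matP W (f e) (g e) (h e)))) fun e =>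
    or_congr_left (and_congr_right fun _ => and_congr_right fun _ => exists_congr fun i => (and_iff_right_of_imp fun hi => ?_).symm)
  exact (num_succ_le_iff.1 le_rfl).trans (matP_lt_len hi)

/-- Right multiplication by J exchanges the columns of each pair: column 2t+1 of the product is the
old column 2t, and column 2t is the negative of the old column 2t+1. Comprehension defines this
directly. -/
theorem exists_mul_J {h s : M.Num} {X J : M.Str} (hJ : isJP (h + h) (matP J))
    (hX : ∀ a b, a < h + h → b < h + h → isIntP (matP X (s + a) (s + b))) :
    ∃ Y, matMulP (h + h) (h + h) (h + h) (blockP (matP X) s s) (matP J) (matP Y) := by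
  rw [isJP_iff] at hJ
  obtain ⟨Y, hY⟩ := exists_matP (M := M)
    (fun a b i => (∃ t, t ≤ b ∧ b = t + t + 1 ∧ matP X (s + a) (s + (t + t)) i) ∨
      ∃ t, t ≤ b ∧ b = t + t ∧ negB (matP X (s + a) (s + (t + t + 1))) i)
    (h + h) (h + h) (M.len X + 1) (by
      rintro a b - - i (⟨t, -, -, h⟩ | ⟨t, -, -, h | h⟩)
      · exact (matP_lt_len h).trans (num_lt_succ_iff.2 le_rfl)
      · exact h.1 ▸ num_lt_succ_iff.2 (num_zero_le _)
      · exact (matP_lt_len h.2).trans (num_lt_succ_iff.2 le_rfl))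
  refine ⟨Y, matMulP_iff.2 fun a b ha hb => ?_⟩
  rw [hY a b ha hb]
  obtain ⟨t, rfl⟩ | ⟨t, rfl⟩ := num_even_or_odd b
  · have ht : t + t + 1 < h + h := by
      have hth : t < h := by
        by_contra hc
        exact hb.not_ge (add_le_add (not_lt.1 hc) (not_lt.1 hc))
      obtain ⟨z, rfl⟩ := num_lt_iff_exists_add.1 hth
      exact num_lt_iff_exists_add.2 ⟨z + z, by ring⟩
    have : Code (blockP (matP X) s s a (t + t + 1)) :=
      inferInstanceAs (Code (matP X (s + a) (s + (t + t + 1))))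
    refine (dotV_single_iff (w := negB (matP X (s + a) (s + (t + t + 1)))) ht (fun l hl hlt => ?_)
      (isIntP_negB _) ?_ _).2 ?_
    · rw [hJ l (t + t) hl hb, sgnB_eq_zeroB not_upperP_even_right fun h => hlt (upperP_even.1 h)]
      exact isProd_zero_right _
    · rw [hJ (t + t + 1) (t + t) ht hb, sgnB_eq_negOneB (upperP_even.2 rfl)]
      exact isProd_negOne_right _
    · refine funext fun i => propext ⟨?_, fun h => .inr ⟨t, num_le_iff_exists_add.2 ⟨t, rfl⟩, rfl, h⟩⟩
      rintro (⟨t', -, h, -⟩ | ⟨t', -, h, h'⟩)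
      · exact absurd h (double_ne_double_succ _ _)
      · rwa [double_inj.1 h]
  · have ht : t + t < h + h := (num_lt_succ_iff.2 le_rfl).trans hb
    have : Code (blockP (matP X) s s a (t + t)) :=
      inferInstanceAs (Code (matP X (s + a) (s + (t + t))))
    refine (dotV_single_iff (w := matP X (s + a) (s + (t + t))) ht (fun l hl hlt => ?_)
      (hX _ _ ha ht) ?_ _).2 ?_
    · rw [hJ l (t + t + 1) hl hb, sgnB_eq_zeroB (fun h => hlt (upperP_odd_right.1 h)) not_upperP_odd]
      exact isProd_zero_right _
    · rw [hJ (t + t) (t + t + 1) ht hb, sgnB_eq_oneB (upperP_even.2 rfl) not_upperP_odd]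
      exact isProd_one_right (hX _ _ ha ht)
    · refine funext fun i => propext ⟨?_, fun h => .inl ⟨t, num_le_iff_exists_add.2 ⟨t + 1, add_assoc _ _ _⟩, rfl, h⟩⟩
      rintro (⟨t', -, h, h'⟩ | ⟨t', -, h, -⟩)
      · rwa [double_inj.1 (add_right_cancel h)]
      · exact absurd h.symm (double_ne_double_succ _ _)

/-! ### The coefficients `R J (M J) ^ r S` -/

theorem exists_row_matP (F : M.Num → BitSet M) [DefPred fun e => F (e 1) (e 0)] (m s : M.Num)
    (hs : ∀ b, b < m → ∀ i, F b i → i < s) : ∃ W, ∀ b, b < m → matP W 0 b = F b := by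
  obtain ⟨W, hW⟩ := exists_matP (fun _ b i => F b i) 1 m s fun _ b _ => hs b
  exact ⟨W, fun b => hW 0 b zero_lt_one⟩

theorem matMulP_one_row {q r : M.Num} {A B C : Matr M} : matMulP 1 q r A B C ↔
    ∀ b, b < r → DotV q (fun l => A 0 l) (fun l => B l b) (C 0 b) := by
  rw [matMulP_iff]
  refine ⟨fun h b => h 0 b zero_lt_one, fun h a b ha => ?_⟩
  rw [← zero_add (1 : M.Num), num_lt_succ_iff] at ha
  rw [le_antisymm ha (num_zero_le a)]
  exact h b

/-- The zero row passes through every product; the powers of MJ are still needed as witnesses. -/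
theorem pbCoeffP_zero {m r : M.Num} {R N S : Matr M} [∀ l, Code (S l 0)] (hR : ∀ l, l < m → R 0 l = zeroB)
    (hex : ∃ J MJ, isJP m (matP J) ∧ matMulP m m m N (matP J) (matP MJ)) (z : BitSet M) :
    pbCoeffP m R N S r z ↔ z = zeroB := by
  have hprod {x : M.Num → BitSet M} (hx : ∀ l, l < m → x l = zeroB) {y : M.Num → BitSet M}
      [∀ l, Code (y l)] (d : BitSet M) : DotV m x y d ↔ d = zeroB :=
    dotV_zero_iff (fun l hl => by rw [hx l hl]; exact isProd_zero_left _) d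
  have hz_iff {U : M.Str} (hU : ∀ b, b < m → matP U 0 b = zeroB) (x : BitSet M) :
      dotP m (matP U) S 0 0 x ↔ x = zeroB := by
    rw [dotP_iff]
    exact hprod hU x
  constructor
  · rintro ⟨J, MJ, P, RJ, U, hJ, hMJ, hP, hRJ, hU, hz⟩
    rw [matMulP_one_row] at hRJ hU
    have hRJ' := fun b hb => (hprod hR _).1 (hRJ b hb)
    exact (hz_iff (fun b hb => (hprod hRJ' _).1 (hU b hb)) z).1 hz
  · rintro rfl
    obtain ⟨J, MJ, hJ, hMJ⟩ := hex
    obtain ⟨P, hP⟩ := exists_matPowP (fun a b ha hb => (matMulP_iff.1 hMJ a b ha hb).isIntP) r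
    obtain ⟨Z, hZ⟩ := exists_row_matP (M := M) (fun _ _ => False) m 0 fun _ _ _ => False.elim
    exact ⟨J, MJ, P, Z, Z, hJ, hMJ, hP, matMulP_one_row.2 fun b hb => (hprod hR _).2 (hZ b hb),
      matMulP_one_row.2 fun b hb => (hprod hZ _).2 (hZ b hb), (hz_iff hZ _).2 rfl⟩

/-- RJ is the unit row at 2s+1, and S is minus the unit column there, so the coefficient is minus
the entry (2s+1, 2s+1) of (NJ)^r. Column 2s+1 of NJ is column 2s of N, which is zero; hence that
entry is 1 for r = 0 and 0 otherwise. -/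
theorem pbCoeffP_iff {m s r : M.Num} {R N S : Matr M} (hs : s + s + 1 < m)
    (hR : ∀ l, l < m → R 0 l = sgnB (l = s + s) False)
    (hS : ∀ l, l < m → S l 0 = sgnB False (l = s + s + 1))
    (hN : ∀ a, a < m → N a (s + s) = zeroB)
    (hex : ∃ J MJ, isJP m (matP J) ∧ matMulP m m m N (matP J) (matP MJ)) (z : BitSet M) :
    pbCoeffP m R N S r z ↔ z = sgnB False (r = 0) := by
  have hs' : s + s < m := (num_lt_succ_iff.2 le_rfl).trans hs
  have hRJ_iff {J : M.Str} (hJ : isJP m (matP J)) (b : M.Num) (hb : b < m) (x : BitSet M) :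
      DotV m (fun l => R 0 l) (fun l => matP J l b) x ↔ x = sgnB (b = s + s + 1) False := by
    rw [isJP_iff] at hJ
    refine dotV_single_iff hs' (fun l hl hlt => ?_) (isIntP_sgnB _ _) ?_ x
    · rw [hR l hl, sgnB_eq_zeroB hlt id]
      exact isProd_zero_left _
    · rw [hR _ hs', sgnB_eq_oneB rfl id, hJ _ _ hs' hb]
      have : sgnB (upperP (s + s) b) (upperP b (s + s)) = (sgnB (b = s + s + 1) False : BitSet M) := by
        simp only [upperP_even, not_upperP_even_right]
      rw [this]
      exact isProd_one_left (isIntP_sgnB _ _)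
  have hU_iff {RJ P : M.Str} (hRJ : ∀ b, b < m → matP RJ 0 b = sgnB (b = s + s + 1) False)
      (hP : ∀ a b, a < m → b < m → isIntP (matP P a b)) (b : M.Num) (hb : b < m) (x : BitSet M) :
      DotV m (fun l => matP RJ 0 l) (fun l => matP P l b) x ↔ x = matP P (s + s + 1) b := by
    refine dotV_single_iff hs (fun l hl hlt => ?_) (hP _ _ hs hb) ?_ x
    · rw [hRJ l hl, sgnB_eq_zeroB hlt id]
      exact isProd_zero_left _
    · rw [hRJ _ hs, sgnB_eq_oneB rfl id]
      exact isProd_one_left (hP _ _ hs hb)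
  have hpow {J MJ P : M.Str} (hJ : isJP m (matP J)) (hMJ : matMulP m m m N (matP J) (matP MJ))
      (hP : matPowP m (matP MJ) r (matP P)) : (∀ a b, a < m → b < m → isIntP (matP P a b)) ∧
      matP P (s + s + 1) (s + s + 1) = sgnB (r = 0) False := by
    obtain ⟨Q, hQ0, hQ, hQP⟩ := hP
    simp only [impP_iff, ltP_iff] at hQ
    rw [eqMatP_iff] at hQP
    refine ⟨fun a b ha hb => ?_, ?_⟩
    · rw [← hQP a b ha hb]
      exact isIntP_of_powers hQ0 hQ le_rfl ha hb
    · rw [← hQP _ _ hs hs]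
      obtain rfl | ⟨r, rfl⟩ := num_eq_zero_or_succ r
      · rw [isIdP_iff.1 hQ0 _ _ hs hs]
        simp
      · rw [sgnB_eq_zeroB (basic_axioms.1 r) id]
        refine (dotV_zero_iff (fun l hl => ?_) _).1
          (matMulP_iff.1 (hQ r (num_lt_succ_iff.2 le_rfl)) _ _ hs hs)
        -- Column 2s+1 of J has its only nonzero entry in row 2s, where it meets the zero column 2s
        -- of N.
        have : matP MJ l (s + s + 1) = zeroB := by
          refine (dotV_zero_iff (fun a ha => ?_) _).1 (matMulP_iff.1 hMJ l (s + s + 1) hl hs)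
          rw [isJP_iff] at hJ
          rw [hJ a _ ha hs]
          by_cases has : a = s + s
          · rw [has, hN l hl]
            exact isProd_zero_left _
          · rw [sgnB_eq_zeroB (fun h => has (upperP_odd_right.1 h)) not_upperP_odd]
            exact isProd_zero_right _
        rw [this]
        exact isProd_zero_right _
  have hz_iff {P U : M.Str} (hU : ∀ b, b < m → matP U 0 b = matP P (s + s + 1) b)
      (hP : matP P (s + s + 1) (s + s + 1) = sgnB (r = 0) False) (x : BitSet M) :
      dotP m (matP U) S 0 0 x ↔ x = sgnB False (r = 0) := by
    rw [dotP_iff]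
    refine dotV_single_iff hs (fun l hl hlt => ?_) (isIntP_sgnB _ _) ?_ x
    · rw [hS l hl, sgnB_eq_zeroB id hlt]
      exact isProd_zero_right _
    · have : (sgnB False (r = 0) : BitSet M) = negB (sgnB (r = 0) False) := by
        by_cases hr : r = 0
        · rw [sgnB_eq_negOneB hr, sgnB_eq_oneB hr id, negB_oneB]
        · rw [sgnB_eq_zeroB id hr, sgnB_eq_zeroB hr id, negB_zeroB]
      rw [hU _ hs, hP, hS _ hs, sgnB_eq_negOneB rfl, this]
      exact isProd_negOne_right _
  constructor
  · rintro ⟨J, MJ, P, RJ, U, hJ, hMJ, hP, hRJ, hU, hz⟩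
    rw [matMulP_one_row] at hRJ hU
    obtain ⟨hPi, hPs⟩ := hpow hJ hMJ hP
    have hRJ' := fun b hb => (hRJ_iff hJ b hb _).1 (hRJ b hb)
    exact (hz_iff (fun b hb => (hU_iff hRJ' hPi b hb _).1 (hU b hb)) hPs z).1 hz
  · rintro rfl
    obtain ⟨J, MJ, hJ, hMJ⟩ := hex
    obtain ⟨P, hP⟩ := exists_matPowP (fun a b ha hb => (matMulP_iff.1 hMJ a b ha hb).isIntP) r
    obtain ⟨hPi, hPs⟩ := hpow hJ hMJ hP
    obtain ⟨RJ, hRJ⟩ := exists_row_matP (M := M)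
      (fun b i => (b = s + s + 1 ∧ i = 1) ∨ (False ∧ (i = 0 ∨ i = 1))) m (1 + 1)
      fun b _ => sgnB_lt _ _
    obtain ⟨U, hU⟩ := exists_row_matP (M := M) (fun b i => matP P (s + s + (1 : M.Num)) b i) m (M.len P)
      fun b _ _ => matP_lt_len
    exact ⟨J, MJ, P, RJ, U, hJ, hMJ, hP,
      matMulP_one_row.2 fun b hb => (hRJ_iff hJ b hb _).2 (hRJ b hb),
      matMulP_one_row.2 fun b hb => (hU_iff hRJ hPi b hb _).2 (hU b hb),
      (hz_iff hU hPs _).2 rfl⟩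

end Matrices

/-! ### The PB matrices of the lower right blocks -/

section PBMatrix
variable {M : Model.{u, v}} [hM : IsModel M]

theorem blockP_blockP (A : Matr M) (s t : M.Num) :
    blockP (blockP A s s) t t = blockP A (s + t) (s + t) := by
  funext a b
  simp only [blockP, add_assoc]

instance (A : Matr M) [h : ∀ a b, Code (A a b)] (s t a b : M.Num) : Code (blockP A s t a b) :=
  h (s + a) (t + b)

theorem sgnB_congr {p q p' q' : Prop} (hp : p ↔ p') (hq : q ↔ q') :
    sgnB p q = (sgnB p' q' : BitSet M) := by
  rw [propext hp, propext hq]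

/-- The coefficients of the PB matrix of a lower right block of `(0, I; -I, 0)`. -/
theorem pbCoeffP_block_iff {n k d : M.Num} {A : M.Str}
    (hA : ∀ a b, a < n + n + (n + n) → b < n + n + (n + n) →
      matP A a b = sgnB (b = a + (n + n)) (a = b + (n + n)))
    (hd : k + d + 1 = n + n) (r : M.Num) (z : BitSet M) :
    pbCoeffP (d + d) (blockP (blockP (matP A) (k + k) (k + k)) 0 (1 + 1))
      (blockP (blockP (matP A) (k + k) (k + k)) (1 + 1) (1 + 1))
      (blockP (blockP (matP A) (k + k) (k + k)) (1 + 1) 1) r z ↔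
      z = sgnB False (k < n ∧ r = 0) := by
  have h0 := num_zero_le (M := M)
  have h1 := zero_lt_one (α := M.Num)
  have hk0 := h0 k
  have hd0 := h0 d
  have hlt (l : M.Num) (hl : l < d + d) : k + k + (1 + 1 + l) < n + n + (n + n) := by
    rw [← hd]; grind
  have hlt0 : k + k + (0 + 0) < n + n + (n + n) := by rw [← hd]; grind
  have hlt1 : k + k + (1 + 0) < n + n + (n + n) := by rw [← hd]; grind
  have hex : ∃ J MJ, isJP (d + d) (matP J) ∧ matMulP (d + d) (d + d) (d + d)
      (blockP (blockP (matP A) (k + k) (k + k)) (1 + 1) (1 + 1)) (matP J) (matP MJ) := by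
    obtain ⟨J, hJ⟩ := exists_isJP (d + d)
    obtain ⟨Y, hY⟩ := exists_mul_J (s := k + k + (1 + 1)) (X := A) hJ fun a b ha hb => by
      rw [add_assoc _ (1 + 1), add_assoc _ (1 + 1), hA _ _ (hlt a ha) (hlt b hb)]
      exact isIntP_sgnB _ _
    exact ⟨J, Y, hJ, by rwa [blockP_blockP]⟩
  have hR (l : M.Num) (hl : l < d + d) :
      blockP (blockP (matP A) (k + k) (k + k)) 0 (1 + 1) 0 l = sgnB (l + 1 + 1 = n + n) False := by
    refine (hA _ _ hlt0 (hlt l hl)).trans (sgnB_congr ⟨fun h => by grind, fun h => by grind⟩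
      ⟨fun h => ?_, False.elim⟩)
    have := h.ge
    have := h0 l
    have := h0 n
    clear h hd
    grind
  have hS (l : M.Num) (hl : l < d + d) :
      blockP (blockP (matP A) (k + k) (k + k)) (1 + 1) 1 l 0 = sgnB False (l + 1 = n + n) := by
    refine (hA _ _ (hlt l hl) hlt1).trans (sgnB_congr ⟨fun h => ?_, False.elim⟩
      ⟨fun h => by grind, fun h => by grind⟩)
    have := h.ge
    have := h0 l
    have := h0 n
    clear h hd
    grind
  by_cases hk : k < n
  · obtain ⟨c, rfl⟩ := num_lt_iff_exists_add.1 hk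
    have hdc : d = k + c + c + 1 := by grind
    have hc0 := h0 c
    rw [pbCoeffP_iff (s := k + c) (by rw [hdc]; grind) (fun l hl => ?_) (fun l hl => ?_)
      (fun a ha => ?_) hex]
    · rw [sgnB_congr Iff.rfl (show r = 0 ↔ k < k + c + 1 ∧ r = 0 from (and_iff_right hk).symm)]
    · rw [hR l hl]
      exact sgnB_congr ⟨fun h => by grind, fun h => by grind⟩ Iff.rfl
    · rw [hS l hl]
      exact sgnB_congr Iff.rfl ⟨fun h => by grind, fun h => by grind⟩
    · have hs : k + c + (k + c) < d + d := by rw [hdc]; grind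
      refine (hA _ _ (hlt a ha) (hlt _ hs)).trans (sgnB_eq_zeroB (fun h => ?_) fun h => ?_)
      · have := h.ge
        have := h0 a
        clear h hd
        grind
      · have := h.ge
        have := hlt a ha
        clear h hd hdc
        grind
  · rw [pbCoeffP_zero (S := blockP (blockP (matP A) (k + k) (k + k)) (1 + 1) 1)
      (fun l hl => ?_) hex, sgnB_eq_zeroB id fun h => hk h.1]
    rw [hR l hl]
    -- For k ≥ n the partner column 2k + 2n of row 2k lies outside the matrix.
    refine sgnB_eq_zeroB (fun h => ?_) id
    have h2 := h.ge
    have h3 := hd.le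
    have h4 := not_lt.1 hk
    clear h hd
    grind

/-- The first subdiagonal vanishes because a = 0, and among the coefficients only r = 0 with k < n
survives. What remains is multiplication by 1 - X^2, or by 1 if k ≥ n. -/
theorem isPBMatrixP_block_iff {n k d : M.Num} {A P : M.Str}
    (hA : ∀ a b, a < n + n + (n + n) → b < n + n + (n + n) →
      matP A a b = sgnB (b = a + (n + n)) (a = b + (n + n)))
    (hd : k + d + 1 = n + n) :
    isPBMatrixP d (blockP (matP A) (k + k) (k + k)) (matP P) ↔ ∀ i j, i < d + 1 + 1 → j < d + 1 →
      matP P i j = sgnB (i = j) (k < n ∧ i = j + 1 + 1) := by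
  have h0 := num_zero_le (M := M)
  have h1 := zero_lt_one (α := M.Num)
  have hk0 := h0 k
  have hd0 := h0 d
  have ha : blockP (matP A) (k + k) (k + k) 0 1 = zeroB := by
    refine (hA _ _ (by rw [← hd]; grind) (by rw [← hd]; grind)).trans
      (sgnB_eq_zeroB (fun h => ?_) fun h => ?_)
    -- An entry 1 at (2k, 2k+1) would force 2n = 1, against parity.
    · have : n + n = 0 + 0 + 1 := by grind
      rw [add_zero] at this
      exact double_ne_double_succ n 0 (by rw [this, add_zero])
    · have := h.ge
      have := h0 n
      clear h hd
      grind
  simp only [isPBMatrixP, impP_iff, ltP_iff, and_imp, pbCoeffP_block_iff hA hd, isZeroP_iff,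
    isOneP_iff, eqBitsP_iff, ha]
  refine forall₄_congr fun i j hi hj => ⟨fun ⟨h1, h2, h3, h4⟩ => ?_, fun h => ?_⟩
  · rcases lt_trichotomy i j with hij | hij | hij
    · rw [h1 hij, sgnB_eq_zeroB hij.ne fun h => ?_]
      rw [h.2] at hij
      grind
    · rw [h2 hij, sgnB_eq_oneB hij fun h => ?_]
      have := (hij.symm.trans h.2).ge
      grind
    · obtain ⟨c, hc⟩ := num_lt_iff_exists_add.1 hij
      -- Below the diagonal, i = j + 1 + c: the value c = 0 is the entry a, and c = r + 1 is
      -- coefficient r.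
      obtain rfl | ⟨c, rfl⟩ := num_eq_zero_or_succ c
      · rw [add_zero] at hc
        rw [h3 hc, sgnB_eq_zeroB hij.ne' fun h => ?_]
        have := (hc.symm.trans h.2).ge
        grind
      · rw [h4 c (by rw [hc]; ring)]
        refine sgnB_congr (iff_of_false id hij.ne') (and_congr_right fun _ => ?_)
        rw [hc]
        exact ⟨fun h => by grind, fun h => by grind⟩
  · rw [h]
    refine ⟨fun hij => sgnB_eq_zeroB hij.ne fun h => ?_, fun hij => sgnB_eq_oneB hij fun h => ?_,
      fun hij => sgnB_eq_zeroB (fun h => ?_) fun h => ?_, fun r hr =>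
        sgnB_congr (iff_of_false (fun h => ?_) id) (and_congr_right fun _ => ?_)⟩
    · rw [h.2] at hij
      grind
    · have := (hij.symm.trans h.2).ge
      grind
    · have := (hij.symm.trans h).le
      grind
    · have := (hij.symm.trans h.2).ge
      grind
    · have := (hr.symm.trans h).le
      have := h0 r
      grind
    · rw [hr]
      exact ⟨fun h => by grind, fun h => by grind⟩

end PBMatrix

/-! ### The Pfaffian: all values, and existence -/

section Pfaffian
variable {M : Model.{u, v}} [hM : IsModel M]

/-- The recursion for the Pfaffian coefficients of the matrix `(0, I; -I, 0)`. -/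
def CoeffRec (n : M.Num) (Q : M.Str) : Prop :=
  ∀ k d, k + d + 1 = n + n → ∀ i, i < d + 1 + 1 →
    DotV (d + 1) (fun j => sgnB (i = j) (k < n ∧ i = j + 1 + 1)) (fun j => matP Q (k + 1) j)
      (matP Q k i)

/-- The PB matrices are determined and exist by comprehension, so their quantifier disappears and
only the explicit recursion remains. -/
theorem pfaffianP_iff {n : M.Num} {A : M.Str} (hA : isBlockIdentityP (n + n) (matP A))
    (z : BitSet M) : pfaffianP (n + n) (matP A) z ↔
      ∃ Q, matP Q (n + n) 0 = oneB ∧ CoeffRec n Q ∧ matP Q 0 (n + n) = z := by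
  rw [isBlockIdentityP_iff] at hA
  simp only [pfaffianP, isOneP_iff, impP_iff, eqBitsP_iff, CoeffRec]
  refine exists_congr fun Q => and_congr_right fun _ => and_congr_left fun _ =>
    forall₃_congr fun k d hd => ?_
  simp only [isPBMatrixP_block_iff hA hd]
  constructor
  · rintro ⟨P, hP, hQ⟩ i hi
    exact (matMulP_iff.1 hQ i 0 hi zero_lt_one).congr (fun j hj => (hP i j hi hj).symm)
      fun _ _ => rfl
  · intro h
    obtain ⟨P, hP⟩ := exists_matP (fun i j x => (i = j ∧ x = 1) ∨
      ((k < n ∧ i = j + 1 + 1) ∧ (x = 0 ∨ x = 1))) (d + 1 + 1) (d + 1) (1 + 1)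
      fun i j _ _ => sgnB_lt _ _
    exact ⟨P, hP, matMulP_iff.2 fun i b hi _ => (h i hi).congr (fun j hj => hP i j hi hj)
      fun _ _ => rfl⟩

theorem isProd_zero_of_left {b c : BitSet M} [Code c] (h : b = zeroB) : IsProd b c zeroB :=
  h ▸ isProd_zero_left c

theorem isProd_zero_of_right {b c : BitSet M} (h : c = zeroB) : IsProd b c zeroB :=
  h ▸ isProd_zero_right b

/-- The coefficient sequences of the lower right blocks that vanish. -/
theorem CoeffRec.of_ge {n : M.Num} {Q : M.Str} (hQ : CoeffRec n Q) (h1 : matP Q (n + n) 0 = oneB)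
    (d : M.Num) : d ≤ n → ∀ k, k ≤ n + n → k + d = n + n →
      matP Q k 0 = oneB ∧ ∀ i, i ≤ d → 0 < i → matP Q k i = zeroB := by
  -- The condition `k ≤ n + n` follows from the equation and serves to bound the quantifier.
  refine num_induction (S := fun d => d ≤ n → ∀ k, k ≤ n + n → k + d = n + n →
    matP Q k 0 = oneB ∧ ∀ i, i ≤ d → 0 < i → matP Q k i = zeroB) ?_ ?_ d
  · rintro - k - h
    rw [add_zero] at h
    exact ⟨h ▸ h1, fun i hi hi' => absurd hi' hi.not_gt⟩
  · intro d ih hd k hk hkd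
    have hkn : ¬ k < n := fun h => (add_lt_add_of_lt_of_le h hd).ne hkd
    rw [← add_assoc] at hkd
    have hkd' : k + 1 + d = n + n := by rw [← hkd]; ring
    have hdn := (num_succ_le_iff.1 hd).le
    obtain ⟨ih0, ih1⟩ := ih hdn (k + 1) (num_le_iff_exists_add.2 ⟨d, hkd'.symm⟩) hkd'
    have hrec := hQ k d hkd
    refine ⟨?_, fun i hi hi' => ?_⟩
    · refine (dotV_single_iff (num_lt_succ_iff.2 (num_zero_le d)) (fun j hj hj' => ?_) isIntP_oneB ?_
        _).1 (hrec 0 (num_lt_succ_iff.2 (num_zero_le _)))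
      · exact isProd_zero_of_left (sgnB_eq_zeroB hj'.symm fun h => hkn h.1)
      · rw [ih0, sgnB_eq_oneB rfl fun h => hkn h.1]
        exact isProd_one_left isIntP_oneB
    · refine (dotV_zero_iff (fun j hj => ?_) _).1 (hrec i (num_lt_succ_iff.2 hi))
      by_cases hij : i = j
      · exact isProd_zero_of_right (ih1 j (num_lt_succ_iff.1 hj) (hij ▸ hi'))
      · exact isProd_zero_of_left (sgnB_eq_zeroB hij fun h => hkn h.1)

/-- With c = n - k, these are the leading coefficient (-1)^c of (1 - X^2)^c at X^(2c) and the zeros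
beyond it. The lower coefficients do not affect them, so the induction needs no binomial
coefficients. -/
theorem CoeffRec.of_le {n : M.Num} {Q : M.Str} (hQ : CoeffRec n Q) (h1 : matP Q (n + n) 0 = oneB)
    (c : M.Num) : c ≤ n → ∀ k, k ≤ n → k + c = n →
      ((∃ t, t ≤ c ∧ c = t + t) → matP Q k (c + c) = oneB) ∧
      ((∃ t, t ≤ c ∧ c = t + t + 1) → matP Q k (c + c) = negOneB) ∧
      ∀ i, i ≤ n + c → c + c < i → matP Q k i = zeroB := by
  refine num_induction (S := fun c => c ≤ n → ∀ k, k ≤ n → k + c = n →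
      ((∃ t, t ≤ c ∧ c = t + t) → matP Q k (c + c) = oneB) ∧
      ((∃ t, t ≤ c ∧ c = t + t + 1) → matP Q k (c + c) = negOneB) ∧
      ∀ i, i ≤ n + c → c + c < i → matP Q k i = zeroB) ?_ ?_ c
  · rintro - k - h
    rw [add_zero] at h
    subst h
    simp only [add_zero]
    obtain ⟨h0, h0'⟩ := hQ.of_ge h1 k le_rfl k (num_le_iff_exists_add.2 ⟨k, rfl⟩) rfl
    refine ⟨fun _ => h0, fun ⟨t, _, ht⟩ => ?_, h0'⟩
    exact absurd ht.symm (basic_axioms.1 _)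
  · rintro c ih hc k hk rfl
    obtain ⟨ih0, ih1, ih2⟩ := ih (num_succ_le_iff.1 hc).le (k + 1) (by
      rw [num_le_iff_exists_add]; exact ⟨c, by ring⟩) (by ring)
    have hrec := hQ k (k + c + c + 1) (by ring)
    have hkc : k < k + (c + 1) := num_lt_iff_exists_add.2 ⟨c, by ring⟩
    have h00 := num_zero_le (M := M)
    have h01 := zero_lt_one (α := M.Num)
    have hk0 := h00 k
    have hc0 := h00 c
    have hj_le {j : M.Num} (hj : j < k + c + c + 1 + 1) : j ≤ k + (c + 1) + c :=
      num_lt_succ_iff.1 (hj.trans_eq (by ring))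
    have hmain {w : BitSet M} [Code w] (hw : isIntP w) (h : matP Q (k + 1) (c + c) = w) :
        matP Q k (c + 1 + (c + 1)) = negB w := by
      -- Position 2c + 2 receives minus the old coefficient at 2c; the old coefficient at 2c + 2 is
      -- already zero.
      refine (dotV_single_iff (a := c + c) (by grind) (fun j hj hjc => ?_) (isIntP_negB w) ?_ _).1
        (hrec (c + 1 + (c + 1)) (by grind))
      · by_cases hij : c + 1 + (c + 1) = j
        · exact isProd_zero_of_right (ih2 j (hj_le hj) (by rw [← hij]; clear hij; grind))
        · exact isProd_zero_of_left (sgnB_eq_zeroB hij fun h => hjc (by grind))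
      · rw [h, sgnB_eq_negOneB ⟨hkc, by ring⟩]
        exact isProd_negOne_left w
    refine ⟨?_, ?_, fun i hi hic => ?_⟩
    · rintro ⟨t, -, ht⟩
      obtain ⟨s, hs⟩ | ⟨s, hs⟩ := num_even_or_odd c
      · exact absurd (ht.symm.trans (by rw [hs])) (double_ne_double_succ t s)
      · rw [hmain isIntP_negOneB (ih1 ⟨s, ?_, hs⟩), negB_negOneB]
        rw [hs, add_assoc]
        exact num_le_iff_exists_add.2 ⟨s + 1, rfl⟩
    · rintro ⟨t, -, ht⟩
      have hct := add_right_cancel ht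
      rw [hmain isIntP_oneB (ih0 ⟨t, ?_, hct⟩), negB_oneB]
      rw [hct]
      exact num_le_iff_exists_add.2 ⟨t, rfl⟩
    · refine (dotV_zero_iff (fun j hj => ?_) _).1 (hrec i (by grind))
      by_cases hij : i = j
      · exact isProd_zero_of_right (ih2 j (hj_le hj) (by rw [← hij]; grind))
      by_cases hij' : i = j + 1 + 1
      · exact isProd_zero_of_right (ih2 j (hj_le hj) (by rw [hij'] at hic; grind))
      · exact isProd_zero_of_left (sgnB_eq_zeroB hij fun h => hij' h.2)

theorem isNegOnePowP_of_coeffRec {n : M.Num} {Q : M.Str} (hQ : CoeffRec n Q)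
    (h1 : matP Q (n + n) 0 = oneB) : isNegOnePowP n (matP Q 0 (n + n)) := by
  obtain ⟨h, h', -⟩ := hQ.of_le h1 n le_rfl 0 (num_zero_le n) (zero_add n)
  obtain ⟨t, ht⟩ | ⟨t, ht⟩ := num_even_or_odd n
  · exact .inl ⟨⟨t, ht⟩, isOneP_iff.2 (h ⟨t, ht ▸ num_le_iff_exists_add.2 ⟨t, rfl⟩, ht⟩)⟩
  · exact .inr ⟨⟨t, ht⟩, isNegOneP_iff.2 (h' ⟨t,
      ht ▸ num_le_iff_exists_add.2 ⟨t + 1, by rw [add_assoc]⟩, ht⟩)⟩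

/-! ### Existence of the coefficients -/

/-- The rows `c ≤ n` of the array are the coefficients of the polynomials `(1 - X ^ 2) ^ c`. -/
theorem exists_powers (n : M.Num) : ∃ P : M.Str,
    (∀ i, i < n + n + 1 → matsP P 0 0 i = sgnB (0 = i) False) ∧
    (∀ c i, c ≤ n → i < n + n + 1 → isIntP (matsP P c 0 i)) ∧
    (∀ c i, c < n → i < n + n + 1 → DotV (n + n + 1) (fun l => matsP P c 0 l)
      (fun l => sgnB (l = i) (i = l + 1 + 1)) (matsP P (c + 1) 0 i)) := by
  -- `B` multiplies row vectors of coefficients by 1 - X^2 modulo X^(2n+1).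
  obtain ⟨B, hB⟩ := exists_matP (M := M) (fun l i x => (l = i ∧ x = 1) ∨
    (i = l + 1 + 1 ∧ (x = 0 ∨ x = 1))) (n + n + 1) (n + n + 1) (1 + 1) fun _ _ _ _ => sgnB_lt _ _
  obtain ⟨Y, P, hP0, hP, -⟩ := exists_matPowP (m := n + n + 1) (X := B)
    (fun a b ha hb => (hB a b ha hb).symm ▸ isIntP_sgnB _ _) n
  simp only [impP_iff, ltP_iff] at hP
  have h0 : (0 : M.Num) < n + n + 1 := num_lt_succ_iff.2 (num_zero_le _)
  refine ⟨P, fun i => isIdP_iff.1 hP0 0 i h0, fun c i hc hi => isIntP_of_powers hP0 hP hc h0 hi,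
    fun c i hc hi => ?_⟩
  exact (matMulP_iff.1 (hP c hc) 0 i h0 hi).congr (fun _ _ => rfl) fun l hl => (hB l i hl hi).symm

/-- The degree of (1 - X^2)^c is at most 2c. This lets `exists_coeffRec` replace the full range of
summation by the shorter one of the recursion. -/
theorem powers_eq_zeroB {n : M.Num} {P : M.Str}
    (h0 : ∀ i, i < n + n + 1 → matsP P 0 0 i = sgnB (0 = i) False)
    (hP : ∀ c i, c < n → i < n + n + 1 → DotV (n + n + 1) (fun l => matsP P c 0 l)
      (fun l => sgnB (l = i) (i = l + 1 + 1)) (matsP P (c + 1) 0 i)) (c : M.Num) :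
    c ≤ n → ∀ i, i < n + n + 1 → c + c < i → matsP P c 0 i = zeroB := by
  refine num_induction (S := fun c => c ≤ n → ∀ i, i < n + n + 1 → c + c < i →
    matsP P c 0 i = zeroB) ?_ ?_ c
  · intro _ i hi hi'
    rw [add_zero] at hi'
    rw [h0 i hi, sgnB_eq_zeroB hi'.ne id]
  · intro c ih hc i hi hic
    have hc := num_succ_le_iff.1 hc
    have h01 := zero_lt_one (α := M.Num)
    refine (dotV_zero_iff (fun l hl => ?_) _).1 (hP c i hc hi)
    by_cases hli : l = i
    · exact isProd_zero_of_left (ih hc.le l hl (by rw [hli]; grind))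
    by_cases hli' : i = l + 1 + 1
    · exact isProd_zero_of_left (ih hc.le l hl (by rw [hli'] at hic; grind))
    · exact isProd_zero_of_right (sgnB_eq_zeroB hli hli')

theorem exists_coeffRec (n : M.Num) : ∃ Q : M.Str, matP Q (n + n) 0 = oneB ∧ CoeffRec n Q := by
  obtain ⟨P, hP0, hPi, hP⟩ := exists_powers n
  have hPz := powers_eq_zeroB hP0 hP
  have h00 := num_zero_le (M := M)
  have h01 := zero_lt_one (α := M.Num)
  -- Row k lists (1 - X^2)^(n-k) for k ≤ n and the constant polynomial 1 for k > n.
  obtain ⟨Q, hQ⟩ := exists_matP (M := M) (fun k i x =>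
    (∃ c, c ≤ n ∧ k + c = n ∧ matsP P c 0 i x) ∨ (n < k ∧ matsP P 0 0 i x))
    (n + n + 1) (n + n + 1) (M.len P) (by
      rintro k i - - x (⟨c, -, -, h⟩ | ⟨-, h⟩) <;> exact matsP_lt_len h)
  have hQc {k c i : M.Num} (hk : k + c = n) (hi : i < n + n + 1) : matP Q k i = matsP P c 0 i := by
    have hkn : k ≤ n := num_le_iff_exists_add.2 ⟨c, hk.symm⟩
    rw [hQ k i (num_lt_succ_iff.2 (hkn.trans (num_le_iff_exists_add.2 ⟨n, rfl⟩))) hi]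
    refine funext fun x => propext ⟨?_, fun h => .inl ⟨c, ?_, hk, h⟩⟩
    · rintro (⟨c', -, hc', h⟩ | ⟨h, -⟩)
      · rwa [← add_left_cancel (hc'.trans hk.symm)]
      · exact absurd hkn h.not_ge
    · exact num_le_iff_exists_add.2 ⟨k, by rw [← hk, add_comm]⟩
  have hQ0 {k i : M.Num} (hk : n ≤ k) (hk' : k < n + n + 1) (hi : i < n + n + 1) :
      matP Q k i = sgnB (0 = i) False := by
    rw [← hP0 i hi]
    obtain rfl | hk := hk.eq_or_lt
    · exact hQc (add_zero n) hi
    rw [hQ k i hk' hi]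
    refine funext fun x => propext ⟨?_, fun h => .inr ⟨hk, h⟩⟩
    rintro (⟨c', -, hc', h⟩ | ⟨-, h⟩)
    · exact absurd (num_le_iff_exists_add.2 ⟨c', hc'.symm⟩) hk.not_ge
    · exact h
  refine ⟨Q, ?_, fun k d hd i hi => ?_⟩
  · rw [hQ0 (num_le_iff_exists_add.2 ⟨n, rfl⟩) (num_lt_succ_iff.2 le_rfl)
      (num_lt_succ_iff.2 (h00 _)), sgnB_eq_oneB rfl id]
  have hk0 := h00 k
  have hd0 := h00 d
  have hin : i < n + n + 1 := hi.trans_le (by rw [← hd]; grind)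
  have hjn {j : M.Num} (hj : j < d + 1) : j < n + n + 1 := hj.trans_le (by rw [← hd]; grind)
  by_cases hk : k < n
  · obtain ⟨c, rfl⟩ := num_lt_iff_exists_add.1 hk
    have hc0 := h00 c
    have hdc : d = k + c + c + 1 := by grind
    have hcn : c < k + c + 1 := by clear hd hdc; grind
    rw [dotV_congr (x' := fun j => sgnB (i = j) (i = j + 1 + 1)) (y' := fun j => matsP P c 0 j)
      (fun j _ => sgnB_congr Iff.rfl (and_iff_right hk)) fun j hj =>
        hQc (k := k + 1) (c := c) (by ring) (hjn hj), hQc (k := k) (c := c + 1) (by ring) hin]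
    have hstep := hP c i hcn hin
    have hleft {j : M.Num} (h : i ≠ j) (h' : i ≠ j + 1 + 1) :
        IsProd (sgnB (i = j) (i = j + 1 + 1)) (matsP P c 0 j) zeroB :=
      isProd_zero_of_left (sgnB_eq_zeroB h h')
    have hright {j : M.Num} (h : i ≠ j) (h' : i ≠ j + 1 + 1) :
        IsProd (matsP P c 0 j) (sgnB (j = i) (i = j + 1 + 1)) zeroB :=
      isProd_zero_of_right (sgnB_eq_zeroB h.symm h')
    have hii : i ≠ i + 1 + 1 := fun h => num_ne_add_succ_add i 1 (by rw [← h])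
    have hl1 : IsProd (sgnB (i = i) (i = i + 1 + 1)) (matsP P c 0 i) (matsP P c 0 i) := by
      rw [sgnB_eq_oneB rfl hii]
      exact isProd_one_left (hPi c i hcn.le hin)
    have hr1 : IsProd (matsP P c 0 i) (sgnB (i = i) (i = i + 1 + 1)) (matsP P c 0 i) := by
      rw [sgnB_eq_oneB rfl hii]
      exact isProd_one_right (hPi c i hcn.le hin)
    -- Powering multiplies by `B` on the right, the recursion by the PB matrix on the left. For i =
    -- t + 2 both sums have the terms t and i, with the same products in the same order; for i < 2
    -- only the term i is left.
    by_cases ht : ∃ t, i = t + 1 + 1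
    · obtain ⟨t, rfl⟩ := ht
      have ht : t < t + 1 + 1 := by grind
      have htd : t < d + 1 := by clear hd hdc; grind
      have hlN : IsProd (sgnB (t + 1 + 1 = t) (t + 1 + 1 = t + 1 + 1)) (matsP P c 0 t)
          (negB (matsP P c 0 t)) := by
        rw [sgnB_eq_negOneB rfl]
        exact isProd_negOne_left _
      have hrN : IsProd (matsP P c 0 t) (sgnB (t = t + 1 + 1) (t + 1 + 1 = t + 1 + 1))
          (negB (matsP P c 0 t)) := by
        rw [sgnB_eq_negOneB rfl]
        exact isProd_negOne_right _
      have hinj {j : M.Num} (h : j ≠ t) : t + 1 + 1 ≠ j + 1 + 1 := fun h' =>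
        h (add_right_cancel (add_right_cancel h')).symm
      rw [dotV_double_iff ht hin (fun l _ h h' => hright h'.symm (hinj h)) (isIntP_negB _) hrN hr1]
        at hstep
      obtain hi | hi := (num_lt_succ_iff.1 hi).lt_or_eq
      · exact (dotV_double_iff ht hi (fun l _ h h' => hleft h'.symm (hinj h)) (isIntP_negB _) hlN
          hl1 _).2 hstep
      -- At i = d + 1 the recursion has no term i. The coefficient there is zero anyway, since d + 1
      -- = k + 2c + 2 exceeds the degree 2c.
      · rw [hPz c hcn.le (t + 1 + 1) hin (by rw [hi, hdc]; clear hd hdc; grind),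
          intAddP_zero_right (isIntP_negB _)] at hstep
        exact (dotV_single_iff htd (fun l hl h => hleft (fun h' => hl.ne (h'.symm.trans hi)) (hinj h))
          (isIntP_negB _) hlN _).2 hstep
    · have ht' (j : M.Num) : i ≠ j + 1 + 1 := fun h => ht ⟨j, h⟩
      -- Here i is 0 or 1, while d = k + 2c + 1 is at least 1.
      have hid : i < d + 1 := by
        obtain rfl | ⟨x, rfl⟩ := num_eq_zero_or_succ i
        · exact num_lt_succ_iff.2 hd0
        obtain rfl | ⟨x, rfl⟩ := num_eq_zero_or_succ x
        · rw [hdc]; clear hd hdc; grind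
        · exact absurd rfl (ht' x)
      rw [dotV_single_iff hin (fun l _ h => hright h.symm (ht' l)) (hPi c i hcn.le hin) hr1] at hstep
      exact (dotV_single_iff hid (fun l _ h => hleft h.symm (ht' l)) (hPi c i hcn.le hin) hl1 _).2
        hstep
  · have hkn := not_lt.1 hk
    have hk1 : k + 1 < n + n + 1 := num_lt_succ_iff.2
      (num_le_iff_exists_add.2 ⟨d, by rw [← hd]; ring⟩)
    rw [dotV_congr (x' := fun j => sgnB (i = j) False) (y' := fun j => sgnB (0 = j) False)
      (fun j _ => sgnB_congr Iff.rfl (iff_of_false (fun h => hk h.1) id)) fun j hj =>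
      hQ0 (hkn.trans (num_lt_succ_iff.2 le_rfl).le) hk1 (hjn hj),
      hQ0 hkn ((num_lt_succ_iff.2 le_rfl).trans hk1) hin]
    by_cases h0i : 0 = i
    · refine (dotV_single_iff (a := 0) (num_lt_succ_iff.2 hd0) (fun j _ hj => ?_) (isIntP_sgnB _ _) ?_
        _).2 rfl
      · exact isProd_zero_of_right (sgnB_eq_zeroB hj.symm id)
      · rw [sgnB_eq_oneB h0i.symm id, sgnB_eq_oneB rfl id, sgnB_eq_oneB h0i id]
        exact isProd_one_left isIntP_oneB
    · refine (dotV_zero_iff (fun j _ => ?_) _).2 (sgnB_eq_zeroB h0i id)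
      by_cases hij : i = j
      · exact isProd_zero_of_right (sgnB_eq_zeroB (hij ▸ h0i) id)
      · exact isProd_zero_of_left (sgnB_eq_zeroB hij id)

theorem exists_isBlockIdentityP (N : M.Num) : ∃ A, isBlockIdentityP N (matP A) := by
  obtain ⟨A, hA⟩ := exists_matP (M := M) (fun a b x => (b = a + N ∧ x = 1) ∨
    (a = b + N ∧ (x = 0 ∨ x = 1))) (N + N) (N + N) (1 + 1) fun _ _ _ _ => sgnB_lt _ _
  exact ⟨A, isBlockIdentityP_iff.2 hA⟩

end Pfaffian
end VSharpL

theorem mainTheorem9 : VSharpL.Proves.{u, v} VSharpL.theory VSharpL.pfBlockIdentity := by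
  rintro M hM _ rfl e E
  have : VSharpL.IsModel M := ⟨hM⟩
  rw [VSharpL.sat_pfBlockIdentity]
  refine fun n => ⟨VSharpL.exists_isBlockIdentityP _, fun A => VSharpL.impP_iff.2 fun hA =>
    ⟨?_, fun Z => VSharpL.impP_iff.2 fun hZ => ?_⟩⟩
  · obtain ⟨Q, hQ1, hQ⟩ := VSharpL.exists_coeffRec n
    obtain ⟨Z, hZ⟩ := VSharpL.Code.exists_eq (VSharpL.matP Q 0 (n + n))
    exact ⟨Z, (VSharpL.pfaffianP_iff hA _).2 ⟨Q, hQ1, hQ, hZ⟩⟩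
  · obtain ⟨Q, hQ1, hQ, hZ⟩ := (VSharpL.pfaffianP_iff hA _).1 hZ
    rw [← hZ]
    exact VSharpL.isNegOnePowP_of_coeffRec hQ hQ1
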